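/- Let $H=\mathbb Z^b$ be a lattice with an integral symmetric bilinear form $q$ of signature $(3,b-3)$ (for instance $H^2(X,\mathbb Z)$ with the Beauville–Bogomolov–Fujiki form, for a simple hyperkähler manifold $X$ with $b_2(X)=b$), and extend $q$ bilinearly to $H\otimes\mathbb R$ and $H\otimes\mathbb C$. Let $$\mathbb P\mathrm{er}=\{\,l\in\mathbb P(H\otimes\mathbb C)\ :\ q(l,l)=0,\ q(l,\bar l)>0\,\}$$ be the period space, a complex manifold of dimension $b-2$, open in a quadric. For $l\in\mathbb P\mathrm{er}$ put $\operatorname{Pic}(l)=\langle l,\bar l\rangle^{\perp}\cap H$ and $V_l=\langle \operatorname{Re} l,\operatorname{Im} l\rangle\subset H\otimes\mathbb R$. For a $3$-dimensional subspace $W\subset H\otimes\mathbb R$ on which $q$ is positive definite, the hyperkähler line of $W$ is $S_W=\{\,l\in\mathbb P\mathrm{er} : V_l\subset W\,\}$; it is called a generic hyperkähler line (GHK line) if $W^{\perp}\cap (H\otimes\mathbb Q)=0$. Let $M$ be a Hausdorff smooth manifold and $\psi:M\to\mathbb P\mathrm{er}$ a local diffeomorphism which is compatible with GHK lines: for every GHK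 line $S$, the space $X=\psi^{-1}(S)$ is the union of a family of pairwise disjoint subsets, each of them closed and open in $X$ and mapped homeomorphically onto $S$ by $\psi$, and of a further subset $Y\subset X$ with $\operatorname{rk}\operatorname{Pic}(\psi(y))>0$ for all $y\in Y$. Then 1. $\psi$ is a covering map; 2. every connected component of $M$ is open, and $\psi$ maps it diffeomorphically onto $\mathbb P\mathrm{er}$; 3. all exceptional sets of $\psi$ are empty: for every connected subset $R\subset\mathbb P\mathrm{er}$ and every connected component $R_\alpha$ of $\psi^{-1}(R)$, the set $R\setminus\psi(R_\alpha)$ is empty. -/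

import Mathlib

open scoped Manifold ContDiff LinearAlgebra.Projectivization

/-- The integral symmetric matrix `G`, viewed as a bilinear form on `R ^ b`. -/
noncomputable def gramForm {b : ℕ} (G : Matrix (Fin b) (Fin b) ℤ) (R : Type) [CommRing R] :
    LinearMap.BilinForm R (Fin b → R) :=
  Matrix.toBilin' (G.map (Int.castRingHom R))

/-- A lattice `(H, q)` of rank `b` and signature `(3, b - 3)`, with a chosen basis: `H = ℤ ^ b`,
and `q` is given by its Gram matrix.  This is the structure carried by the second cohomology of a
simple hyperkähler manifold with its Beauville-Bogomolov-Fujiki form; `H ⊗ R` is `Fin b → R`. -/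
structure BBFLattice (b : ℕ) where
  gram : Matrix (Fin b) (Fin b) ℤ
  symm : gram.IsSymm
  sigPos_eq : sigPos (gramForm gram ℝ).toQuadraticMap = 3
  sigNeg_eq : sigNeg (gramForm gram ℝ).toQuadraticMap + 3 = b

/-- The quotient topology on the projective space of `ℂ ^ b`. -/
noncomputable instance projectivizationTopology (b : ℕ) : TopologicalSpace (ℙ ℂ (Fin b → ℂ)) :=
  TopologicalSpace.coinduced (Projectivization.mk' ℂ) inferInstance

namespace BBFLattice

variable {b : ℕ} (Λ : BBFLattice b)

/-- The form `q`, extended `R`-bilinearly to `H ⊗ R`. -/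
noncomputable def form (R : Type) [CommRing R] : LinearMap.BilinForm R (Fin b → R) :=
  gramForm Λ.gram R

/-- The period space `{ l ∈ ℙ (H ⊗ ℂ) | q(l, l) = 0, q(l, conj l) > 0 }`.  The two conditions do
not depend on the representative (see `mk_mem_periodDomain`), and `q(v, conj v)` is always real. -/
def periodDomain : Set (ℙ ℂ (Fin b → ℂ)) :=
  {l | Λ.form ℂ l.rep l.rep = 0 ∧ 0 < (Λ.form ℂ l.rep (star l.rep)).re}

/-- The period space as a type, with the topology induced from the projective space. -/
abbrev Per : Type := Λ.periodDomain

/-- The real subspace `⟨Re l, Im l⟩` of `H ⊗ ℝ` attached to a point `l` of the period space. -/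
noncomputable def plane (l : Λ.Per) : Submodule ℝ (Fin b → ℝ) :=
  Submodule.span ℝ {fun i => (l.1.rep i).re, fun i => (l.1.rep i).im}

/-- `W` is a positive three-dimensional subspace of `H ⊗ ℝ`. -/
def IsPositiveThreeSpace (W : Submodule ℝ (Fin b → ℝ)) : Prop :=
  Module.finrank ℝ W = 3 ∧ ∀ w ∈ W, w ≠ 0 → 0 < Λ.form ℝ w w

/-- The hyperkähler line `S_W`: all points of the period space whose plane lies in `W`. -/
def hkLine (W : Submodule ℝ (Fin b → ℝ)) : Set Λ.Per :=
  {l | Λ.plane l ≤ W}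

/-- `S_W` is a generic hyperkähler line: `W` is a positive three-dimensional subspace
and `W^⊥ ∩ (H ⊗ ℚ) = 0`. -/
def IsGHK (W : Submodule ℝ (Fin b → ℝ)) : Prop :=
  Λ.IsPositiveThreeSpace W ∧
    ∀ x : Fin b → ℚ, (∀ w ∈ W, Λ.form ℝ (fun i => (x i : ℝ)) w = 0) → x = 0

/-- The Picard (Néron-Severi) lattice `⟨l, conj l⟩^⊥ ∩ H` of a point of the period space. -/
noncomputable def pic (l : Λ.Per) : Submodule ℤ (Fin b → ℤ) where
  carrier := {x | Λ.form ℂ l.1.rep (fun i => (x i : ℂ)) = 0 ∧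
    Λ.form ℂ (star l.1.rep) (fun i => (x i : ℂ)) = 0}
  zero_mem' := by
    have h : (fun i => (((0 : Fin b → ℤ) i : ℤ) : ℂ)) = 0 := by ext; simp
    simp only [Set.mem_ofPred_eq, h, map_zero, and_self]
  add_mem' {x y} hx hy := by
    have h : (fun i => (((x + y) i : ℤ) : ℂ)) = (fun i => (x i : ℂ)) + fun i => (y i : ℂ) := by
      ext; simp
    simp only [Set.mem_ofPred_eq] at hx hy ⊢
    rw [h, map_add, map_add, hx.1, hx.2, hy.1, hy.2]
    simp
  smul_mem' n x hx := by
    have h : (fun i => (((n • x) i : ℤ) : ℂ)) = (n : ℂ) • fun i => (x i : ℂ) := by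
      ext; simp
    simp only [Set.mem_ofPred_eq] at hx ⊢
    rw [h, map_smul, map_smul, hx.1, hx.2]
    simp

/-- The map `ψ : M → Per` is compatible with generic hyperkähler lines: for each of them, `S`, the
space `X = ψ⁻¹(S)` is the union of a family of pairwise disjoint copies of `S`
(that is, subsets mapped homeomorphically onto `S` by `ψ`), each closed and open in `X`, and of a
set `Y` whose image consists of points with Picard lattice of positive rank. -/
def CompatibleWithGHKLines {M : Type*} [TopologicalSpace M] (ψ : M → Λ.Per) : Prop :=
  ∀ W : Submodule ℝ (Fin b → ℝ), Λ.IsGHK W →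
    ∃ (copies : Set (Set M)) (Y : Set M),
      ψ ⁻¹' Λ.hkLine W = ⋃₀ copies ∪ Y ∧
      copies.PairwiseDisjoint id ∧
      (∀ T ∈ copies,
        IsClosed ((↑) ⁻¹' T : Set (ψ ⁻¹' Λ.hkLine W)) ∧
        IsOpen ((↑) ⁻¹' T : Set (ψ ⁻¹' Λ.hkLine W)) ∧
        ∃ e : T ≃ₜ Λ.hkLine W, ∀ x : T, (e x : Λ.Per) = ψ x) ∧
      ∀ y ∈ Y, 0 < Module.finrank ℤ (Λ.pic (ψ y))

/-! ### The period space as a manifold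

Around a point `l₀ = [v₀]` of the period space, with `c = q(v₀, conj v₀)`, every line `l` with
`q(l, conj v₀) ≠ 0` has a unique representative `v₀ + u - q(u, u) / (2 c) • conj v₀` with `u` in
`⟨v₀, conj v₀⟩^⊥`, and `u` is the coordinate of `l`. -/

theorem form_symm (v w : Fin b → ℂ) : Λ.form ℂ v w = Λ.form ℂ w v := by
  simp only [form, gramForm, Matrix.toBilin'_apply, Matrix.map_apply]
  rw [Finset.sum_comm]
  refine Finset.sum_congr rfl fun i _ => Finset.sum_congr rfl fun j _ => ?_
  rw [Λ.symm.apply i j]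
  ring

theorem form_star (v w : Fin b → ℂ) : Λ.form ℂ (star v) (star w) = star (Λ.form ℂ v w) := by
  simp only [form, gramForm, Matrix.toBilin'_apply, star_sum, star_mul', Pi.star_apply,
    Matrix.map_apply, Int.coe_castRingHom]
  simp

theorem mk_mem_periodDomain (v : Fin b → ℂ) (hv : v ≠ 0) :
    Projectivization.mk ℂ v hv ∈ Λ.periodDomain ↔
      Λ.form ℂ v v = 0 ∧ 0 < (Λ.form ℂ v (star v)).re := by
  obtain ⟨a, ha⟩ := (Projectivization.mk_eq_mk_iff' ℂ _ v (Projectivization.rep_nonzero _) hv).1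
    (Projectivization.mk_rep (Projectivization.mk ℂ v hv))
  have ha0 : a ≠ 0 := by
    rintro rfl
    exact Projectivization.rep_nonzero (Projectivization.mk ℂ v hv) (by rw [← ha, zero_smul])
  rw [periodDomain, Set.mem_ofPred_eq, ← ha]
  have h1 : Λ.form ℂ (a • v) (star (a • v)) = (Complex.normSq a : ℂ) * Λ.form ℂ v (star v) := by
    have h : a * star a = (Complex.normSq a : ℂ) := Complex.mul_conj a
    rw [star_smul, map_smul, map_smul, LinearMap.smul_apply, smul_eq_mul, smul_eq_mul, ← h]
    ring
  have h2 : Λ.form ℂ (a • v) (a • v) = a * (a * Λ.form ℂ v v) := by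
    rw [map_smul, map_smul, LinearMap.smul_apply, smul_eq_mul, smul_eq_mul]
  rw [h1, h2, Complex.re_ofReal_mul, mul_pos_iff_of_pos_left (Complex.normSq_pos.2 ha0)]
  simp [ha0]

/-- The orthogonal complement of `v₀` and `conj v₀` in `H ⊗ ℂ`. -/
noncomputable def orth (v₀ : Fin b → ℂ) : Submodule ℂ (Fin b → ℂ) :=
  LinearMap.ker ((Λ.form ℂ v₀).prod (Λ.form ℂ (star v₀)))

theorem mem_orth {v₀ u : Fin b → ℂ} :
    u ∈ Λ.orth v₀ ↔ Λ.form ℂ v₀ u = 0 ∧ Λ.form ℂ (star v₀) u = 0 := by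
  simp [orth, LinearMap.mem_ker]

variable (l₀ : Λ.Per)

/-- The chosen representative of a point of the period space. -/
noncomputable def base : Fin b → ℂ := l₀.1.rep

noncomputable def baseNorm : ℂ := Λ.form ℂ (Λ.base l₀) (star (Λ.base l₀))

theorem base_base : Λ.form ℂ (Λ.base l₀) (Λ.base l₀) = 0 := l₀.2.1

theorem starBase_starBase : Λ.form ℂ (star (Λ.base l₀)) (star (Λ.base l₀)) = 0 := by
  rw [form_star, base_base, star_zero]

theorem baseNorm_ne_zero : Λ.baseNorm l₀ ≠ 0 := by
  intro h
  have := l₀.2.2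
  change 0 < (Λ.baseNorm l₀).re at this
  rw [h] at this
  simp at this

theorem starBase_base : Λ.form ℂ (star (Λ.base l₀)) (Λ.base l₀) = Λ.baseNorm l₀ :=
  Λ.form_symm _ _

theorem finrank_orth : Module.finrank ℂ (Λ.orth (Λ.base l₀)) = b - 2 := by
  have hc := Λ.baseNorm_ne_zero l₀
  have hs : Function.Surjective
      ((Λ.form ℂ (Λ.base l₀)).prod (Λ.form ℂ (star (Λ.base l₀)))) := by
    rintro ⟨x, y⟩
    refine ⟨(x / Λ.baseNorm l₀) • star (Λ.base l₀) + (y / Λ.baseNorm l₀) • Λ.base l₀, ?_⟩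
    have h : Λ.form ℂ (Λ.base l₀) (star (Λ.base l₀)) = Λ.baseNorm l₀ := rfl
    ext
    · simp [base_base, h, hc]
    · simp [starBase_base, starBase_starBase, hc]
  have h := LinearMap.finrank_range_add_finrank_ker
    ((Λ.form ℂ (Λ.base l₀)).prod (Λ.form ℂ (star (Λ.base l₀))))
  rw [LinearMap.range_eq_top.2 hs] at h
  simp at h
  rw [orth]
  omega

/-- Linear coordinates on `⟨v₀, conj v₀⟩^⊥`. -/
noncomputable def orthEquiv : Λ.orth (Λ.base l₀) ≃ₗ[ℂ] (Fin (b - 2) → ℂ) :=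
  LinearEquiv.ofFinrankEq _ _ (by rw [finrank_orth]; simp)

/-- The orthogonal projection to `⟨v₀, conj v₀⟩^⊥`, in linear coordinates. -/
noncomputable def coord : (Fin b → ℂ) →ₗ[ℂ] (Fin (b - 2) → ℂ) :=
  (Λ.orthEquiv l₀).toLinearMap ∘ₗ
    LinearMap.codRestrict (Λ.orth (Λ.base l₀))
      (LinearMap.id
        - ((Λ.baseNorm l₀)⁻¹ • Λ.form ℂ (star (Λ.base l₀))).smulRight (Λ.base l₀)
        - ((Λ.baseNorm l₀)⁻¹ • Λ.form ℂ (Λ.base l₀)).smulRight (star (Λ.base l₀)))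
      (by
        intro v
        have hc := Λ.baseNorm_ne_zero l₀
        have h : Λ.form ℂ (Λ.base l₀) (star (Λ.base l₀)) = Λ.baseNorm l₀ := rfl
        rw [mem_orth]
        simp only [LinearMap.sub_apply, LinearMap.id_apply, LinearMap.smulRight_apply,
          LinearMap.smul_apply, map_sub, map_smul, smul_eq_mul, base_base, starBase_base,
          starBase_starBase, h]
        constructor <;> field_simp <;> ring)

/-- The inclusion of `⟨v₀, conj v₀⟩^⊥`, in linear coordinates. -/
noncomputable def incl : (Fin (b - 2) → ℂ) →ₗ[ℂ] (Fin b → ℂ) :=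
  (Λ.orth (Λ.base l₀)).subtype ∘ₗ (Λ.orthEquiv l₀).symm.toLinearMap

theorem base_incl (u : Fin (b - 2) → ℂ) : Λ.form ℂ (Λ.base l₀) (Λ.incl l₀ u) = 0 :=
  (Λ.mem_orth.1 ((Λ.orthEquiv l₀).symm u).2).1

theorem starBase_incl (u : Fin (b - 2) → ℂ) : Λ.form ℂ (star (Λ.base l₀)) (Λ.incl l₀ u) = 0 :=
  (Λ.mem_orth.1 ((Λ.orthEquiv l₀).symm u).2).2

theorem incl_coord (v : Fin b → ℂ) : Λ.incl l₀ (Λ.coord l₀ v) =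
    v - ((Λ.baseNorm l₀)⁻¹ * Λ.form ℂ (star (Λ.base l₀)) v) • Λ.base l₀
      - ((Λ.baseNorm l₀)⁻¹ * Λ.form ℂ (Λ.base l₀) v) • star (Λ.base l₀) := by
  simp [incl, coord]

theorem incl_injective : Function.Injective (Λ.incl l₀) :=
  Subtype.val_injective.comp (Λ.orthEquiv l₀).symm.injective

/-- The normalized representative `v₀ + u - q(u, u) / (2 c) • conj v₀` of the line with
coordinate `u`. -/
noncomputable def lift (u : Fin (b - 2) → ℂ) : Fin b → ℂ :=
  Λ.base l₀ + Λ.incl l₀ u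
    - (Λ.form ℂ (Λ.incl l₀ u) (Λ.incl l₀ u) / (2 * Λ.baseNorm l₀)) • star (Λ.base l₀)

theorem starBase_lift (u : Fin (b - 2) → ℂ) :
    Λ.form ℂ (star (Λ.base l₀)) (Λ.lift l₀ u) = Λ.baseNorm l₀ := by
  simp [lift, starBase_base, starBase_incl, starBase_starBase]

theorem lift_ne_zero (u : Fin (b - 2) → ℂ) : Λ.lift l₀ u ≠ 0 := by
  intro h
  have := Λ.starBase_lift l₀ u
  rw [h, map_zero] at this
  exact Λ.baseNorm_ne_zero l₀ this.symm

theorem form_lift_lift (u : Fin (b - 2) → ℂ) :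
    Λ.form ℂ (Λ.lift l₀ u) (Λ.lift l₀ u) = 0 := by
  have hc := Λ.baseNorm_ne_zero l₀
  have h1 : Λ.form ℂ (Λ.base l₀) (star (Λ.base l₀)) = Λ.baseNorm l₀ := rfl
  have h2 : Λ.form ℂ (Λ.incl l₀ u) (Λ.base l₀) = 0 := by rw [form_symm, base_incl]
  have h3 : Λ.form ℂ (Λ.incl l₀ u) (star (Λ.base l₀)) = 0 := by rw [form_symm, starBase_incl]
  simp only [lift, map_add, map_sub, map_smul, LinearMap.add_apply, LinearMap.sub_apply,
    LinearMap.smul_apply, smul_eq_mul, base_base, starBase_base, starBase_incl, base_incl,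
    starBase_starBase, h1, h2, h3]
  field_simp
  ring

theorem coord_lift (u : Fin (b - 2) → ℂ) : Λ.coord l₀ (Λ.lift l₀ u) = u := by
  have hc := Λ.baseNorm_ne_zero l₀
  apply Λ.incl_injective l₀
  have h : Λ.form ℂ (Λ.base l₀) (Λ.lift l₀ u) =
      - (Λ.form ℂ (Λ.incl l₀ u) (Λ.incl l₀ u) / 2) := by
    have h1 : Λ.form ℂ (Λ.base l₀) (star (Λ.base l₀)) = Λ.baseNorm l₀ := rfl
    simp only [lift, map_add, map_sub, map_smul, smul_eq_mul, base_base, base_incl, h1]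
    field_simp
    ring
  rw [incl_coord, starBase_lift, h, inv_mul_cancel₀ hc, lift]
  have : (Λ.baseNorm l₀)⁻¹ * -(Λ.form ℂ (Λ.incl l₀ u) (Λ.incl l₀ u) / 2) =
      - (Λ.form ℂ (Λ.incl l₀ u) (Λ.incl l₀ u) / (2 * Λ.baseNorm l₀)) := by
    field_simp
  rw [this]
  module

theorem lift_coord (v : Fin b → ℂ) (h0 : Λ.form ℂ v v = 0)
    (h1 : Λ.form ℂ (star (Λ.base l₀)) v = Λ.baseNorm l₀) : Λ.lift l₀ (Λ.coord l₀ v) = v := by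
  have hc := Λ.baseNorm_ne_zero l₀
  obtain ⟨t, ht⟩ : ∃ t : ℂ, Λ.lift l₀ (Λ.coord l₀ v) = v + t • star (Λ.base l₀) := by
    refine ⟨-((Λ.baseNorm l₀)⁻¹ * Λ.form ℂ (Λ.base l₀) v)
      - Λ.form ℂ (Λ.incl l₀ (Λ.coord l₀ v)) (Λ.incl l₀ (Λ.coord l₀ v)) / (2 * Λ.baseNorm l₀), ?_⟩
    rw [lift]
    nth_rewrite 1 [incl_coord]
    rw [h1, inv_mul_cancel₀ hc]
    module
  have h := Λ.form_lift_lift l₀ (Λ.coord l₀ v)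
  have h2 : Λ.form ℂ v (star (Λ.base l₀)) = Λ.baseNorm l₀ := by rw [form_symm, h1]
  rw [ht] at h
  simp only [map_add, map_smul, LinearMap.add_apply, LinearMap.smul_apply, smul_eq_mul, h0, h1, h2,
    starBase_starBase] at h
  have ht0 : t = 0 := by
    have : t * Λ.baseNorm l₀ * 2 = 0 := by linear_combination h
    simpa [hc] using this
  rw [ht, ht0, zero_smul, add_zero]

/-- The coordinate of the line spanned by `v`. -/
noncomputable def chartVec (v : Fin b → ℂ) : Fin (b - 2) → ℂ :=
  (Λ.baseNorm l₀ / Λ.form ℂ (star (Λ.base l₀)) v) • Λ.coord l₀ v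

theorem chartVec_smul {a : ℂ} (ha : a ≠ 0) (v : Fin b → ℂ) :
    Λ.chartVec l₀ (a • v) = Λ.chartVec l₀ v := by
  rw [chartVec, chartVec, map_smul, map_smul, smul_smul, smul_eq_mul]
  congr 1
  by_cases h : Λ.form ℂ (star (Λ.base l₀)) v = 0
  · simp [h]
  · field_simp

theorem exists_rep_mk (v : Fin b → ℂ) (hv : v ≠ 0) :
    ∃ a : ℂ, a ≠ 0 ∧ (Projectivization.mk ℂ v hv).rep = a • v := by
  obtain ⟨a, ha⟩ := (Projectivization.mk_eq_mk_iff' ℂ _ v (Projectivization.rep_nonzero _) hv).1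
    (Projectivization.mk_rep (Projectivization.mk ℂ v hv))
  refine ⟨a, ?_, ha.symm⟩
  rintro rfl
  exact Projectivization.rep_nonzero (Projectivization.mk ℂ v hv) (by rw [← ha, zero_smul])

theorem continuous_form_right (w : Fin b → ℂ) : Continuous fun v => Λ.form ℂ w v :=
  LinearMap.continuous_of_finiteDimensional (Λ.form ℂ w)

theorem contDiff_form_right (w : Fin b → ℂ) : ContDiff ℝ ∞ fun v => Λ.form ℂ w v :=
  (((Λ.form ℂ w).toContinuousLinearMap).contDiff (n := ∞)).restrict_scalars ℝ

theorem contDiff_coord : ContDiff ℝ ∞ (Λ.coord l₀) :=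
  (((Λ.coord l₀).toContinuousLinearMap).contDiff (n := ∞)).restrict_scalars ℝ

theorem contDiff_incl : ContDiff ℝ ∞ (Λ.incl l₀) :=
  (((Λ.incl l₀).toContinuousLinearMap).contDiff (n := ∞)).restrict_scalars ℝ

theorem contDiff_form_self : ContDiff ℝ ∞ fun v : Fin b → ℂ => Λ.form ℂ v v := by
  simp only [form, gramForm, Matrix.toBilin'_apply]
  fun_prop

theorem contDiff_lift : ContDiff ℝ ∞ (Λ.lift l₀) := by
  unfold lift
  refine (contDiff_const.add (Λ.contDiff_incl l₀)).sub ?_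
  exact ((Λ.contDiff_form_self.comp (Λ.contDiff_incl l₀)).div_const _).smul contDiff_const

theorem contDiffOn_chartVec :
    ContDiffOn ℝ ∞ (Λ.chartVec l₀) {v | Λ.form ℂ (star (Λ.base l₀)) v ≠ 0} := by
  unfold chartVec
  have h : ContDiffOn ℝ ∞ (fun v => Λ.form ℂ (star (Λ.base l₀)) v)
      {v | Λ.form ℂ (star (Λ.base l₀)) v ≠ 0} := (Λ.contDiff_form_right _).contDiffOn
  simp only [div_eq_mul_inv]
  exact (contDiffOn_const.mul (h.inv fun _ hv => hv)).smul (Λ.contDiff_coord l₀).contDiffOn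

theorem continuous_form_star : Continuous fun v : Fin b → ℂ => (Λ.form ℂ v (star v)).re := by
  simp only [form, gramForm, Matrix.toBilin'_apply, Pi.star_apply]
  fun_prop

theorem isOpen_preimage_of_mk {s : Set (ℙ ℂ (Fin b → ℂ))}
    (h : IsOpen {v : {v : Fin b → ℂ // v ≠ 0} | Projectivization.mk ℂ v.1 v.2 ∈ s}) : IsOpen s :=
  h

theorem isOpen_chartSource :
    IsOpen {l : ℙ ℂ (Fin b → ℂ) | Λ.form ℂ (star (Λ.base l₀)) l.rep ≠ 0} := by
  apply isOpen_preimage_of_mk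
  have : {v : {v : Fin b → ℂ // v ≠ 0} | Projectivization.mk ℂ v.1 v.2 ∈
      {l : ℙ ℂ (Fin b → ℂ) | Λ.form ℂ (star (Λ.base l₀)) l.rep ≠ 0}} =
      {v | Λ.form ℂ (star (Λ.base l₀)) v.1 ≠ 0} := by
    ext ⟨v, hv⟩
    obtain ⟨a, ha, h⟩ := exists_rep_mk v hv
    simp [h, ha]
  rw [this]
  exact isOpen_ne_fun ((Λ.continuous_form_right _).comp continuous_subtype_val) continuous_const

theorem continuousOn_chartVec_rep :
    ContinuousOn (fun l : ℙ ℂ (Fin b → ℂ) => Λ.chartVec l₀ l.rep)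
      {l | Λ.form ℂ (star (Λ.base l₀)) l.rep ≠ 0} := by
  rw [(Λ.isOpen_chartSource l₀).continuousOn_iff]
  intro l hl
  rw [ContinuousAt]
  have hq : Topology.IsQuotientMap
      (Projectivization.mk' ℂ : {v : Fin b → ℂ // v ≠ 0} → ℙ ℂ (Fin b → ℂ)) :=
    ⟨⟨rfl⟩, Quotient.mk''_surjective⟩
  have key : ContinuousOn (fun l : ℙ ℂ (Fin b → ℂ) => Λ.chartVec l₀ l.rep)
      {l | Λ.form ℂ (star (Λ.base l₀)) l.rep ≠ 0} := by
    rw [hq.continuousOn_isOpen_iff (Λ.isOpen_chartSource l₀)]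
    have he : (fun l : ℙ ℂ (Fin b → ℂ) => Λ.chartVec l₀ l.rep) ∘ Projectivization.mk' ℂ =
        fun v : {v : Fin b → ℂ // v ≠ 0} => Λ.chartVec l₀ v.1 := by
      ext1 ⟨v, hv⟩
      obtain ⟨a, ha, h⟩ := exists_rep_mk v hv
      simp [h, Λ.chartVec_smul l₀ ha]
    rw [he]
    refine (Λ.contDiffOn_chartVec l₀).continuousOn.comp continuous_subtype_val.continuousOn ?_
    rintro ⟨v, hv⟩ h
    obtain ⟨a, ha, h'⟩ := exists_rep_mk v hv
    simpa [h', ha] using h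
  exact key.continuousAt ((Λ.isOpen_chartSource l₀).mem_nhds hl)

theorem lift_chartVec_rep (l : Λ.Per) (hl : Λ.form ℂ (star (Λ.base l₀)) l.1.rep ≠ 0) :
    Projectivization.mk ℂ (Λ.lift l₀ (Λ.chartVec l₀ l.1.rep)) (Λ.lift_ne_zero l₀ _) = l.1 := by
  have h : Λ.lift l₀ (Λ.chartVec l₀ l.1.rep) =
      (Λ.baseNorm l₀ / Λ.form ℂ (star (Λ.base l₀)) l.1.rep) • l.1.rep := by
    rw [chartVec, ← map_smul]
    apply lift_coord
    · have h0 : Λ.form ℂ l.1.rep l.1.rep = 0 := l.2.1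
      simp [h0]
    · rw [map_smul, smul_eq_mul, div_mul_cancel₀ _ hl]
  refine Eq.trans ?_ l.1.mk_rep
  exact (Projectivization.mk_eq_mk_iff' ℂ _ _ _ _).2 ⟨_, h.symm⟩

open Classical in
/-- The chart of the period space at `l₀`. -/
noncomputable def chart : OpenPartialHomeomorph Λ.Per (Fin (b - 2) → ℂ) where
  toFun l := Λ.chartVec l₀ l.1.rep
  invFun u := if h : 0 < (Λ.form ℂ (Λ.lift l₀ u) (star (Λ.lift l₀ u))).re then
      ⟨Projectivization.mk ℂ (Λ.lift l₀ u) (Λ.lift_ne_zero l₀ u),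
        (Λ.mk_mem_periodDomain _ _).2 ⟨Λ.form_lift_lift l₀ u, h⟩⟩
    else l₀
  source := {l | Λ.form ℂ (star (Λ.base l₀)) l.1.rep ≠ 0}
  target := {u | 0 < (Λ.form ℂ (Λ.lift l₀ u) (star (Λ.lift l₀ u))).re}
  map_source' := by
    intro l hl
    have hm : Projectivization.mk ℂ _ (Λ.lift_ne_zero l₀ (Λ.chartVec l₀ l.1.rep)) ∈
        Λ.periodDomain := by
      rw [Λ.lift_chartVec_rep l₀ l hl]
      exact l.2
    exact ((Λ.mk_mem_periodDomain _ _).1 hm).2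
  map_target' := by
    intro u hu
    have hu' : 0 < (Λ.form ℂ (Λ.lift l₀ u) (star (Λ.lift l₀ u))).re := hu
    obtain ⟨a, ha, h⟩ := exists_rep_mk _ (Λ.lift_ne_zero l₀ u)
    simp [hu', h, ha, starBase_lift, Λ.baseNorm_ne_zero l₀]
  left_inv' := by
    intro l hl
    have hm : Projectivization.mk ℂ _ (Λ.lift_ne_zero l₀ (Λ.chartVec l₀ l.1.rep)) ∈
        Λ.periodDomain := by
      rw [Λ.lift_chartVec_rep l₀ l hl]
      exact l.2
    rw [dif_pos ((Λ.mk_mem_periodDomain _ _).1 hm).2]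
    exact Subtype.ext (Λ.lift_chartVec_rep l₀ l hl)
  right_inv' := by
    intro u hu
    have hu' : 0 < (Λ.form ℂ (Λ.lift l₀ u) (star (Λ.lift l₀ u))).re := hu
    obtain ⟨a, ha, h⟩ := exists_rep_mk _ (Λ.lift_ne_zero l₀ u)
    rw [dif_pos hu']
    change Λ.chartVec l₀ (Projectivization.mk ℂ _ _).rep = u
    rw [h, chartVec_smul _ _ ha, chartVec, starBase_lift, div_self (Λ.baseNorm_ne_zero l₀),
      one_smul, coord_lift]
  continuousOn_toFun :=
    (Λ.continuousOn_chartVec_rep l₀).comp continuous_subtype_val.continuousOn fun _ h => h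
  continuousOn_invFun := by
    rw [Topology.IsInducing.subtypeVal.continuousOn_iff]
    have h : Continuous fun u => Projectivization.mk ℂ (Λ.lift l₀ u) (Λ.lift_ne_zero l₀ u) := by
      have h1 : Continuous fun u => (⟨Λ.lift l₀ u, Λ.lift_ne_zero l₀ u⟩ :
          {v : Fin b → ℂ // v ≠ 0}) := (Λ.contDiff_lift l₀).continuous.subtype_mk _
      exact continuous_coinduced_rng.comp h1
    refine h.continuousOn.congr ?_
    intro u hu
    have hu' : 0 < (Λ.form ℂ (Λ.lift l₀ u) (star (Λ.lift l₀ u))).re := hu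
    simp [hu']
  open_source := (Λ.isOpen_chartSource l₀).preimage continuous_subtype_val
  open_target := isOpen_lt continuous_const
    (Λ.continuous_form_star.comp (Λ.contDiff_lift l₀).continuous)

noncomputable instance : ChartedSpace (Fin (b - 2) → ℂ) Λ.Per where
  atlas := Set.range Λ.chart
  chartAt := Λ.chart
  mem_chart_source l := by
    change Λ.form ℂ (star (Λ.base l)) (Λ.base l) ≠ 0
    rw [starBase_base]
    exact Λ.baseNorm_ne_zero l
  chart_mem_atlas l := ⟨l, rfl⟩

/-- The period space is a smooth manifold of complex dimension `b - 2`. -/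
instance : IsManifold 𝓘(ℝ, Fin (b - 2) → ℂ) ∞ Λ.Per := by
  apply isManifold_of_contDiffOn
  rintro _ _ ⟨l₀, rfl⟩ ⟨l₁, rfl⟩
  simp only [modelWithCornersSelf_coe, modelWithCornersSelf_coe_symm, Function.id_comp,
    Function.comp_id, Set.preimage_id, Set.range_id, Set.inter_univ]
  have hsrc : ∀ u ∈ ((Λ.chart l₀).symm ≫ₕ Λ.chart l₁).source,
      Λ.form ℂ (star (Λ.base l₁)) (Λ.lift l₀ u) ≠ 0 ∧
      ((Λ.chart l₀).symm ≫ₕ Λ.chart l₁) u = Λ.chartVec l₁ (Λ.lift l₀ u) := by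
    intro u hu
    rw [OpenPartialHomeomorph.trans_source] at hu
    have hu1 : 0 < (Λ.form ℂ (Λ.lift l₀ u) (star (Λ.lift l₀ u))).re := hu.1
    have hs : ((Λ.chart l₀).symm u).1 =
        Projectivization.mk ℂ (Λ.lift l₀ u) (Λ.lift_ne_zero l₀ u) := by
      change (dite _ _ _ : Λ.Per).1 = _
      rw [dif_pos hu1]
    have hu2 : Λ.form ℂ (star (Λ.base l₁)) ((Λ.chart l₀).symm u).1.rep ≠ 0 := hu.2
    obtain ⟨a, ha, h⟩ := exists_rep_mk _ (Λ.lift_ne_zero l₀ u)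
    rw [hs, h] at hu2
    refine ⟨fun h0 => hu2 (by rw [map_smul, h0, smul_zero]), ?_⟩
    change Λ.chartVec l₁ ((Λ.chart l₀).symm u).1.rep = _
    rw [hs, h, chartVec_smul _ _ ha]
  refine ContDiffOn.congr (f := fun u => Λ.chartVec l₁ (Λ.lift l₀ u)) ?_ fun u hu => (hsrc u hu).2
  exact (Λ.contDiffOn_chartVec l₁).comp (Λ.contDiff_lift l₀).contDiffOn fun u hu => (hsrc u hu).1

end BBFLattice

/-- The exceptional set `R \ ψ(R_α)` of a map `ψ` over a set `R`, where `R_α` is the connected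
component of `ψ⁻¹(R)` that contains `x`. -/
def exceptionalSet {X Y : Type*} [TopologicalSpace X] (ψ : X → Y) (R : Set Y) (x : X) : Set Y :=
  R \ ψ '' connectedComponentIn (ψ ⁻¹' R) x

/-! All three conclusions follow from one fact: through every point `x` of `M` passes a continuous
global section of `ψ`. The image of such a section is open and closed in `M`, and it is connected
because the period space is; so it is the component of `x`, and the rest is formal.

To build the section, put `ψ x` on a GHK line `S_W`, which exists by a Baire argument, and let
`F(l)` be the hermitian square of the projection of a representative `v` to `W ⊗ ℂ`, divided by
`q(v, conj v)`. Since `q` is negative definite on `W^⊥`, one has `F ≥ 1` with equality exactly on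
`S_W`, and all sublevel sets of `F` are compact. Over `S_W = {F ≤ 1}` compatibility gives a section
through `x` (`CompatibleWithGHKLines.exists_section`): even a point of the exceptional part `Y` can
be joined inside `ψ⁻¹(S_W)` to a point with trivial Picard lattice, that point lies on a copy of
`S_W`, and copies are open and closed.

The section is then pushed up through the sets `{F ≤ s}`. Passing from a compact sublevel set to a
slightly larger one only uses that `ψ` is a local homeomorphism. Passing from `{F < s}` to `{F ≤ s}`
is the heart of the matter: from every `p` with `F(p) > 1` starts a curve inside some GHK line along
which `F` decreases (`IsOrthonormal.exists_localDescent`). Sections over that line lift the curve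
with any prescribed end point, and this produces the limit of the section at `p`
(`IsSectionOn.exists_tendsto`). Descent to a minimum of `F` also shows that extensions are unique
and, as `S_W` is a connected conic, that the period space is connected. -/

/-! ### Extending a section along the sublevel sets of an exhaustion function. -/

section ExtendingSections

open Set Filter Topology

variable {X M : Type*} [TopologicalSpace X] [TopologicalSpace M]

/-- A local flow near `p` which strictly decreases the function `F`. -/
structure LocalDescent (F : X → ℝ) (p : X) where
  flow : ℝ → X → X
  len : ℝ
  nhd : Set X
  len_pos : 0 < len
  nhd_mem : nhd ∈ 𝓝 p
  continuousOn_flow : ContinuousOn (Function.uncurry flow) (Icc 0 len ×ˢ nhd)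
  flow_zero : ∀ q ∈ nhd, flow 0 q = q
  lt_of_pos : ∀ q ∈ nhd, ∀ t, 0 < t → t ≤ len → F (flow t q) < F q

namespace LocalDescent

variable {F : X → ℝ} {p : X} (d : LocalDescent F p)

theorem self_mem : p ∈ d.nhd := mem_of_mem_nhds d.nhd_mem

theorem flow_le {q : X} (hq : q ∈ d.nhd) {t : ℝ} (ht : t ∈ Icc 0 d.len) :
    F (d.flow t q) ≤ F q := by
  rcases ht.1.eq_or_lt with h | h
  · rw [← h, d.flow_zero q hq]
  · exact (d.lt_of_pos q hq t h ht.2).le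

theorem continuousOn_curve {q : X} (hq : q ∈ d.nhd) :
    ContinuousOn (fun t => d.flow t q) (Icc 0 d.len) :=
  d.continuousOn_flow.comp (f := fun t : ℝ => (t, q)) (by fun_prop) fun _ ht => ⟨ht, hq⟩

theorem tendsto_curve {q : X} (hq : q ∈ d.nhd) :
    Tendsto (fun t => d.flow t q) (𝓝[>] 0) (𝓝 q) := by
  have h : ContinuousWithinAt (fun t => d.flow t q) (Icc 0 d.len) 0 :=
    d.continuousOn_curve hq 0 ⟨le_rfl, d.len_pos.le⟩
  rw [ContinuousWithinAt, d.flow_zero q hq] at h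
  refine h.mono_left ?_
  rw [nhdsWithin_le_iff]
  exact mem_of_superset (Ioc_mem_nhdsGT d.len_pos) Ioc_subset_Icc_self

theorem mem_closure_sublevel {p : X} (d : LocalDescent F p) : p ∈ closure {x | F x < F p} := by
  refine mem_closure_of_tendsto (d.tendsto_curve d.self_mem) ?_
  filter_upwards [Ioc_mem_nhdsGT d.len_pos] with t ht
  exact d.lt_of_pos p d.self_mem t ht.1 ht.2

end LocalDescent

/-- `σ` is a continuous section of `ψ` over `S`. -/
def IsSectionOn (ψ : M → X) (S : Set X) (σ : X → M) : Prop :=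
  ContinuousOn σ S ∧ ∀ x ∈ S, ψ (σ x) = x

theorem IsSectionOn.mono {ψ : M → X} {S T : Set X} {σ : X → M} (h : IsSectionOn ψ S σ)
    (hT : T ⊆ S) : IsSectionOn ψ T σ :=
  ⟨h.1.mono hT, fun x hx => h.2 x (hT hx)⟩

variable {ψ : M → X} {F : X → ℝ} {s : ℝ}

/-- If `F` can be decreased near every point where it exceeds `a`, then a nonempty set which is
compact and stable under small descent meets `{F ≤ a}`. -/
theorem exists_le_of_isCompact_of_descent {A : Set X} {a : ℝ} (hF : Continuous F)
    (hA : IsCompact A) (hne : A.Nonempty)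
    (h : ∀ p ∈ A, a < F p → ∃ q ∈ A, F q < F p) : ∃ p ∈ A, F p ≤ a := by
  obtain ⟨p, hp, hmin⟩ := hA.exists_isMinOn hne hF.continuousOn
  refine ⟨p, hp, not_lt.1 fun hlt => ?_⟩
  obtain ⟨q, hq, hqp⟩ := h p hp hlt
  exact (hmin hq).not_gt hqp

/-- A clopen set contains, with each of its points, the whole descent curve from that point, so
minimizing `F` on it leads down to `{F ≤ a}`. Hence a separation of the space would separate the
connected set `{F ≤ a}`. -/
theorem preconnectedSpace_of_localDescent {a : ℝ} (hF : Continuous F)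
    (hc : ∀ s, IsCompact {x | F x ≤ s}) (hd : ∀ p, a < F p → Nonempty (LocalDescent F p))
    (h0 : IsPreconnected {x | F x ≤ a}) : PreconnectedSpace X := by
  have key : ∀ A : Set X, IsClopen A → A.Nonempty → ({x | F x ≤ a} ∩ A).Nonempty := by
    intro A hA ⟨x, hx⟩
    obtain ⟨p, hp, hpa⟩ := exists_le_of_isCompact_of_descent (a := a) hF
      ((hc (F x)).inter_right hA.isClosed) ⟨x, show F x ≤ F x from le_rfl, hx⟩ (by
        rintro p ⟨hp1, hp2⟩ hlt
        obtain ⟨d⟩ := hd p hlt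
        have hcon : IsPreconnected ((fun t => d.flow t p) '' Icc 0 d.len) :=
          isPreconnected_Icc.image _ (d.continuousOn_curve d.self_mem)
        have hsub := hcon.subset_isClopen hA
          ⟨p, ⟨0, ⟨le_rfl, d.len_pos.le⟩, d.flow_zero p d.self_mem⟩, hp2⟩
        have hlt' := d.lt_of_pos p d.self_mem d.len d.len_pos le_rfl
        exact ⟨d.flow d.len p, ⟨hlt'.le.trans hp1,
          hsub ⟨d.len, ⟨d.len_pos.le, le_rfl⟩, rfl⟩⟩, hlt'⟩)
    exact ⟨p, hpa, hp.2⟩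
  refine ⟨isPreconnected_of_forall_constant fun f hf x _ y _ => ?_⟩
  rw [continuousOn_univ] at hf
  by_contra hxy
  have hx := key _ ((isClopen_discrete {f x}).preimage hf) ⟨x, rfl⟩
  have hy := key _ ((isClopen_discrete {f y}).preimage hf) ⟨y, rfl⟩
  obtain ⟨x', hx1, hx2⟩ := hx
  obtain ⟨y', hy1, hy2⟩ := hy
  have hx2 : f x' = f x := hx2
  have hy2 : f y' = f y := hy2
  exact hxy (by rw [← hx2, ← hy2]; exact h0.constant hf.continuousOn hx1 hy1)

/-- Sections over a sublevel set are determined by their values on a smaller one. -/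
theorem IsSectionOn.eqOn_of_localDescent [T2Space M] (hψ : IsLocalHomeomorph ψ) {a : ℝ}
    (hF : Continuous F) (hc : ∀ s, IsCompact {x | F x ≤ s})
    (hd : ∀ p, a < F p → Nonempty (LocalDescent F p)) {σ τ : X → M}
    (hσ : IsSectionOn ψ {x | F x ≤ s} σ) (hτ : IsSectionOn ψ {x | F x ≤ s} τ)
    (h0 : ∀ x, F x ≤ s → F x ≤ a → σ x = τ x) : EqOn σ τ {x | F x ≤ s} := by
  intro x hx
  by_contra hne
  set K : Set X := {x | F x ≤ s}
  have hsep : IsSeparatedMap ψ := T2Space.isSeparatedMap ψ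
  have hinj : IsLocallyInjective ψ := hψ.isLocallyInjective
  -- Two lifts through a locally injective map agree on an open set, so the locus of disagreement is
  -- closed in the compact set `K`.
  have hop : IsOpen {y : K | σ y = τ y} := hinj.isOpen_eqLocus
    (continuousOn_iff_continuous_domRestrict.1 hσ.1)
    (continuousOn_iff_continuous_domRestrict.1 hτ.1)
    (funext fun y => (hσ.2 y y.2).trans (hτ.2 y y.2).symm)
  have hA : IsCompact {y : X | y ∈ K ∧ σ y ≠ τ y} := by
    have h1 : IsClosed {y : K | σ y ≠ τ y} := by
      rw [← isOpen_compl_iff]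
      convert hop using 1
      ext y
      simp
    have : CompactSpace K := isCompact_iff_compactSpace.1 (hc s)
    convert h1.isCompact.image continuous_subtype_val using 1
    ext y
    simp [and_comm]
  -- Agreement at the end of a descent curve would propagate back to its start; so the end is again
  -- a point of disagreement, with a smaller value of `F`.
  obtain ⟨p, hp, hpa⟩ := exists_le_of_isCompact_of_descent (a := a) hF hA ⟨x, hx, hne⟩ (by
    rintro p ⟨hpK, hp⟩ hlt
    obtain ⟨d⟩ := hd p hlt
    have hlen := d.lt_of_pos p d.self_mem d.len d.len_pos le_rfl
    have hm : MapsTo (fun t => d.flow t p) (Icc 0 d.len) K := fun t ht =>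
      (d.flow_le d.self_mem ht).trans hpK
    refine ⟨d.flow d.len p, ⟨hm ⟨d.len_pos.le, le_rfl⟩, fun heq => hp ?_⟩, hlen⟩
    have := hsep.eqOn_of_comp_eqOn hinj (isPreconnected_Icc (a := 0) (b := d.len))
      (hσ.1.comp (d.continuousOn_curve d.self_mem) hm)
      (hτ.1.comp (d.continuousOn_curve d.self_mem) hm)
      (fun t ht => (hσ.2 _ (hm ht)).trans (hτ.2 _ (hm ht)).symm)
      (a := d.len) ⟨d.len_pos.le, le_rfl⟩ heq (x := 0) ⟨le_rfl, d.len_pos.le⟩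
    simpa [d.flow_zero p d.self_mem] using this)
  exact hp.2 (h0 p hp.1 hpa)

/-- Near a boundary point at which `F` can be decreased, the part of a neighbourhood in the open
sublevel set lies in a preconnected subset of the sublevel set. -/
theorem LocalDescent.exists_isPreconnected [LocallyConnectedSpace X] (hF : Continuous F) {p : X}
    (d : LocalDescent F p) {N : Set X} (hN : N ∈ 𝓝 p) :
    ∃ N' ∈ 𝓝 p, ∃ Z : Set X, IsPreconnected Z ∧ Z ⊆ N ∩ {x | F x < F p} ∧
      N' ∩ {x | F x < F p} ⊆ Z := by
  have h0 : Tendsto (Function.uncurry d.flow) (𝓝[Icc 0 d.len] 0 ×ˢ 𝓝 p) (𝓝 p) := by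
    have := d.continuousOn_flow (0, p) ⟨⟨le_rfl, d.len_pos.le⟩, d.self_mem⟩
    rw [ContinuousWithinAt, nhdsWithin_prod_eq, nhdsWithin_eq_nhds.2 d.nhd_mem] at this
    simpa [Function.uncurry, d.flow_zero p d.self_mem] using this
  obtain ⟨T, hT, N₁, hN₁, hsub⟩ := mem_prod_iff.1 (h0 (interior_mem_nhds.2 hN))
  rw [nhdsWithin_Icc_eq_nhdsGE d.len_pos] at hT
  obtain ⟨δ', hδ', hδT'⟩ := mem_nhdsGE_iff_exists_Icc_subset.1 hT
  set δ := min δ' d.len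
  have hδ : 0 < δ := lt_min hδ' d.len_pos
  have hδl : δ ≤ d.len := min_le_right _ _
  have hin : ∀ t ∈ Icc 0 δ, ∀ q ∈ N₁, d.flow t q ∈ interior N := fun t ht q hq =>
    hsub (mk_mem_prod (hδT' ⟨ht.1, ht.2.trans (min_le_left _ _)⟩) hq)
  have hδm : δ ∈ Icc 0 δ := ⟨hδ.le, le_rfl⟩
  obtain ⟨O, hO, hOo, hpO, hOc⟩ := locallyConnectedSpace_iff_subsets_isOpen_isConnected.1
    inferInstance (d.flow δ p) (interior N ∩ {x | F x < F p})
    ((isOpen_interior.inter (isOpen_lt hF continuous_const)).mem_nhds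
      ⟨hin δ hδm p (mem_of_mem_nhds hN₁), d.lt_of_pos p d.self_mem δ hδ hδl⟩)
  have hcont : ContinuousAt (fun q => d.flow δ q) p :=
    (d.continuousOn_flow.comp (f := fun q : X => (δ, q)) (s := d.nhd) (by fun_prop)
      fun q hq => ⟨⟨hδ.le, hδl⟩, hq⟩).continuousAt d.nhd_mem
  -- `Z` consists of the connected open set `O` around `d.flow δ p` and of all trajectories up to
  -- time `δ` that start below the level of `p` and end in `O`. Each trajectory is connected and
  -- meets `O`, and none leaves `N` or rises above its start.
  refine ⟨N₁ ∩ d.nhd ∩ (fun q => d.flow δ q) ⁻¹' O,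
    inter_mem (inter_mem hN₁ d.nhd_mem) (hcont (hOo.mem_nhds hpO)),
    O ∪ ⋃ q ∈ N₁ ∩ d.nhd ∩ (fun q => d.flow δ q) ⁻¹' O ∩ {x | F x < F p},
      (fun t => d.flow t q) '' Icc 0 δ, ?_, ?_, ?_⟩
  · refine isPreconnected_of_forall (d.flow δ p) ?_
    rintro y (hy | hy)
    · exact ⟨O, subset_union_left, hpO, hy, hOc.isPreconnected⟩
    · obtain ⟨q, hq, hy⟩ := mem_iUnion₂.1 hy
      refine ⟨O ∪ (fun t => d.flow t q) '' Icc 0 δ,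
        union_subset_union_right _ (subset_biUnion_of_mem (u := fun q =>
          (fun t => d.flow t q) '' Icc 0 δ) hq), Or.inl hpO, Or.inr hy, ?_⟩
      exact hOc.isPreconnected.union (d.flow δ q) hq.1.2 ⟨δ, hδm, rfl⟩
        (isPreconnected_Icc.image _ ((d.continuousOn_curve hq.1.1.2).mono
          (Icc_subset_Icc_right hδl)))
  · refine union_subset (hO.trans (inter_subset_inter_left _ interior_subset)) ?_
    refine iUnion₂_subset ?_
    rintro q ⟨⟨⟨hq1, hq2⟩, hq3⟩, hq4⟩ _ ⟨t, ht, rfl⟩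
    exact ⟨interior_subset (hin t ht q hq1),
      (d.flow_le hq2 ⟨ht.1, ht.2.trans hδl⟩).trans_lt hq4⟩
  · intro q hq
    exact Or.inr (mem_biUnion hq ⟨0, ⟨le_rfl, hδ.le⟩, d.flow_zero q hq.1.1.2⟩)

/-- The descent curve `t ↦ d.flow t p` can be lifted along `ψ`, with any prescribed end point. -/
def LocalDescent.HasLifts {p : X} (d : LocalDescent F p) (ψ : M → X) : Prop :=
  ∀ m, ψ m = d.flow d.len p → ∃ g : ℝ → M, ContinuousOn g (Icc 0 d.len) ∧
    (∀ t ∈ Icc 0 d.len, ψ (g t) = d.flow t p) ∧ g d.len = m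

/-- A section over an open sublevel set has a limit at each boundary point which is the start of a
descent curve with lifts. -/
theorem IsSectionOn.exists_tendsto [LocallyConnectedSpace X] [T2Space M]
    (hψ : IsLocalHomeomorph ψ) (hF : Continuous F) {p : X} (d : LocalDescent F p)
    (hl : d.HasLifts ψ) {σ : X → M} (hσ : IsSectionOn ψ {x | F x < F p} σ) :
    ∃ y, ψ y = p ∧ Tendsto σ (𝓝[{x | F x < F p}] p) (𝓝 y) := by
  have hsep : IsSeparatedMap ψ := T2Space.isSeparatedMap ψ
  have hinj : IsLocallyInjective ψ := hψ.isLocallyInjective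
  have hlt : ∀ t ∈ Ioc 0 d.len, F (d.flow t p) < F p := fun t ht =>
    d.lt_of_pos p d.self_mem t ht.1 ht.2
  have hlen : d.len ∈ Ioc 0 d.len := ⟨d.len_pos, le_rfl⟩
  obtain ⟨g, hg, hgψ, hgl⟩ := hl (σ (d.flow d.len p)) (hσ.2 _ (hlt _ hlen))
  -- Away from time `0`, both `g` and `σ` along the curve lift the same path and have the same end.
  -- So `g 0` is the only candidate for the limit.
  have hgσ : EqOn g (fun t => σ (d.flow t p)) (Ioc 0 d.len) :=
    hsep.eqOn_of_comp_eqOn hinj isPreconnected_Ioc (hg.mono Ioc_subset_Icc_self)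
      (hσ.1.comp ((d.continuousOn_curve d.self_mem).mono Ioc_subset_Icc_self) hlt)
      (fun t ht => (hgψ t (Ioc_subset_Icc_self ht)).trans (hσ.2 _ (hlt t ht)).symm) hlen hgl
  have hg0 : ψ (g 0) = p := (hgψ 0 ⟨le_rfl, d.len_pos.le⟩).trans (d.flow_zero p d.self_mem)
  refine ⟨g 0, hg0, ?_⟩
  obtain ⟨e, hes, he⟩ := hψ (g 0)
  have hpe : p ∈ e.target := by
    rw [← hg0, he]
    exact e.map_source hes
  obtain ⟨N', hN', Z, hZ, hZN, hN'Z⟩ := d.exists_isPreconnected hF (e.open_target.mem_nhds hpe)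
  have hgt : Tendsto g (𝓝[>] 0) (𝓝 (g 0)) := by
    have h : ContinuousWithinAt g (Icc 0 d.len) 0 := hg 0 ⟨le_rfl, d.len_pos.le⟩
    refine h.mono_left ?_
    rw [nhdsWithin_le_iff]
    exact mem_of_superset (Ioc_mem_nhdsGT d.len_pos) Ioc_subset_Icc_self
  have hev : ∀ᶠ t in 𝓝[>] (0 : ℝ), t ∈ Ioc 0 d.len := Ioc_mem_nhdsGT d.len_pos
  obtain ⟨t, ht, htN, hte⟩ := (hev.and (((d.tendsto_curve d.self_mem).eventually_mem hN').and
    (hgt.eventually_mem (e.open_source.mem_nhds hes)))).exists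
  -- On the connected set `Z` both maps are sections of `ψ`, and they agree at a point of the
  -- descent curve close to `p`.
  have hσe : EqOn σ e.symm Z := by
    refine hsep.eqOn_of_comp_eqOn hinj hZ (hσ.1.mono fun x hx => (hZN hx).2)
      (e.continuousOn_symm.mono fun x hx => (hZN hx).1) (fun x hx => ?_)
      (hN'Z ⟨htN, hlt t ht⟩) ?_
    · refine (hσ.2 x (hZN hx).2).trans ?_
      simp [he, e.right_inv (hZN hx).1]
    · rw [← hgψ t (Ioc_subset_Icc_self ht), he, e.left_inv hte, ← he,
        hgψ t (Ioc_subset_Icc_self ht)]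
      exact (hgσ ht).symm
  have hlim : Tendsto e.symm (𝓝[{x | F x < F p}] p) (𝓝 (g 0)) := by
    have := (e.continuousAt_symm hpe).tendsto
    have h2 : e.symm p = g 0 := by rw [← hg0, he, e.left_inv hes]
    rw [h2] at this
    exact this.mono_left nhdsWithin_le_nhds
  refine hlim.congr' ?_
  filter_upwards [self_mem_nhdsWithin, mem_nhdsWithin_of_mem_nhds hN'] with x hx1 hx2
  exact (hσe (hN'Z ⟨hx2, hx1⟩)).symm

/-- Extension of a section from an open sublevel set to the closed one. -/
theorem IsSectionOn.exists_extend_closed [LocallyConnectedSpace X] [T2Space M] [RegularSpace M]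
    (hψ : IsLocalHomeomorph ψ) (hF : Continuous F)
    (hd : ∀ p, F p = s → ∃ d : LocalDescent F p, d.HasLifts ψ) {σ : X → M}
    (hσ : IsSectionOn ψ {x | F x < s} σ) :
    ∃ τ, IsSectionOn ψ {x | F x ≤ s} τ ∧ EqOn τ σ {x | F x < s} := by
  have hop : IsOpen {x | F x < s} := isOpen_lt hF continuous_const
  have hcl : {x | F x ≤ s} ⊆ closure {x | F x < s} := by
    intro x hx
    rcases (show F x ≤ s from hx).lt_or_eq with h | h
    · exact subset_closure h
    · obtain ⟨d, -⟩ := hd x h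
      exact h ▸ d.mem_closure_sublevel
  have hlim : ∀ x ∈ {x | F x ≤ s}, ∃ y, ψ y = x ∧ Tendsto σ (𝓝[{x | F x < s}] x) (𝓝 y) := by
    intro x hx
    rcases (show F x ≤ s from hx).lt_or_eq with h | h
    · exact ⟨σ x, hσ.2 x h, hσ.1 x h⟩
    · obtain ⟨d, hl⟩ := hd x h
      subst h
      exact hσ.exists_tendsto hψ hF d hl
  -- The pointwise limits form a continuous map because `M` is regular.
  refine ⟨extendFrom {x | F x < s} σ, ⟨continuousOn_extendFrom hcl fun x hx => ?_, ?_⟩, ?_⟩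
  · obtain ⟨y, -, hy⟩ := hlim x hx
    exact ⟨y, hy⟩
  · intro x hx
    obtain ⟨y, hy1, hy2⟩ := hlim x hx
    rw [extendFrom_eq (hcl hx) hy2, hy1]
  · intro x hx
    exact extendFrom_eq (subset_closure hx) (hσ.1 x hx)

/-- Extension of a section from a compact sublevel set to a larger one. -/
theorem IsSectionOn.exists_extend_open [T2Space X]
    (hψ : IsLocalHomeomorph ψ) (hF : Continuous F) (hc : ∀ s, IsCompact {x | F x ≤ s})
    {σ : X → M} (hσ : IsSectionOn ψ {x | F x ≤ s} σ) :
    ∃ ε > 0, ∃ τ, IsSectionOn ψ {x | F x ≤ s + ε} τ ∧ EqOn τ σ {x | F x ≤ s} := by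
  rcases isEmpty_or_nonempty X with hX | ⟨⟨x₀⟩⟩
  · exact ⟨1, one_pos, σ, ⟨fun x => hX.elim x, fun x => hX.elim x⟩, fun x => hX.elim x⟩
  have : Nonempty M := ⟨σ x₀⟩
  set K := {x | F x ≤ s}
  have hinj : InjOn ψ (σ '' K) := by
    rintro _ ⟨x, hx, rfl⟩ _ ⟨y, hy, rfl⟩ h
    rw [hσ.2 x hx, hσ.2 y hy] at h
    rw [h]
  -- `ψ` is injective on the compact set `σ '' K` and locally injective around it, hence injective
  -- on an open neighbourhood `V`. The inverse of `ψ` on `V` is the extension.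
  obtain ⟨V, hVo, hKV, hV⟩ := hinj.exists_isOpen_superset ((hc s).image_of_continuousOn hσ.1)
    (fun x _ => hψ.continuous.continuousAt) fun x _ => by
      obtain ⟨e, hx, he⟩ := hψ x
      exact ⟨e.source, e.open_source.mem_nhds hx, he ▸ e.injOn⟩
  have hUo : IsOpen (ψ '' V) := hψ.isOpenMap _ hVo
  have hKU : K ⊆ ψ '' V := fun x hx => ⟨σ x, hKV ⟨x, hx, rfl⟩, hσ.2 x hx⟩
  -- On the compact part of `{F ≤ s + 1}` outside of `ψ '' V` the minimum of `F` exceeds `s`; half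
  -- of the gap is a safe `ε`.
  obtain ⟨ε, hε, hεU⟩ : ∃ ε > 0, {x | F x ≤ s + ε} ⊆ ψ '' V := by
    rcases ({x | F x ≤ s + 1} \ ψ '' V).eq_empty_or_nonempty with h | h
    · exact ⟨1, one_pos, sdiff_eq_empty.1 h⟩
    · obtain ⟨p, hp, hmin⟩ := ((hc (s + 1)).diff hUo).exists_isMinOn h hF.continuousOn
      have hps : s < F p := not_le.1 fun hle => hp.2 (hKU hle)
      refine ⟨min 1 ((F p - s) / 2), lt_min one_pos (by linarith), fun x hx => ?_⟩
      by_contra hxU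
      have hx' : F x ≤ s + min 1 ((F p - s) / 2) := hx
      have h1 := min_le_left 1 ((F p - s) / 2)
      have h2 := min_le_right 1 ((F p - s) / 2)
      have h3 : F p ≤ F x := hmin ⟨show F x ≤ s + 1 by linarith, hxU⟩
      linarith
  let e : OpenPartialHomeomorph M X := OpenPartialHomeomorph.ofContinuousOpen
    (hV.toPartialEquiv ψ V) hψ.continuous.continuousOn hψ.isOpenMap hVo
  refine ⟨ε, hε, e.symm, ⟨e.continuousOn_symm.mono hεU, fun x hx => e.right_inv (hεU hx)⟩, ?_⟩
  intro x hx
  have h1 : ψ (e.symm x) = ψ (σ x) := (e.right_inv (hKU hx)).trans (hσ.2 x hx).symm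
  exact hV (e.map_target (hKU hx)) (hKV ⟨x, hx, rfl⟩) h1

/-- A section over `{F ≤ a}` extends to a global section, if all sublevel sets of `F` are compact
and every point with `F > a` is the start of a descent curve with lifts. -/
theorem IsSectionOn.exists_extend_univ [LocallyConnectedSpace X] [T2Space X] [T2Space M]
    [RegularSpace M] (hψ : IsLocalHomeomorph ψ) {a : ℝ} (hF : Continuous F)
    (hc : ∀ s, IsCompact {x | F x ≤ s})
    (hd : ∀ p, a < F p → ∃ d : LocalDescent F p, d.HasLifts ψ)
    {σ₀ : X → M} (hσ₀ : IsSectionOn ψ {x | F x ≤ a} σ₀) :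
    ∃ σ, IsSectionOn ψ univ σ ∧ EqOn σ σ₀ {x | F x ≤ a} := by
  have hd' : ∀ p, a < F p → Nonempty (LocalDescent F p) := fun p hp => ⟨(hd p hp).choose⟩
  -- The levels to which `σ₀` extends. Agreement is required only where both bounds hold, so that
  -- `L` is closed downwards even below `a`.
  let L : Set ℝ := {s | ∃ σ, IsSectionOn ψ {x | F x ≤ s} σ ∧ ∀ x, F x ≤ s → F x ≤ a → σ x = σ₀ x}
  have hLa : a ∈ L := ⟨σ₀, hσ₀, fun _ _ _ => rfl⟩
  have hLdown : ∀ s ∈ L, ∀ t ≤ s, t ∈ L := by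
    rintro s ⟨σ, hσ, h⟩ t hts
    exact ⟨σ, hσ.mono fun x (hx : F x ≤ t) => hx.trans hts, fun x hx => h x (hx.trans hts)⟩
  have hglue : ∀ U : Set X, IsOpen U → (∀ x ∈ U, ∃ s ∈ L, F x < s) →
      ∃ σ, IsSectionOn ψ U σ ∧ ∀ x ∈ U, F x ≤ a → σ x = σ₀ x := by
    intro U hU hUL
    have hex : ∀ x, ∃ σ : X → M, F x ∈ L →
        IsSectionOn ψ {y | F y ≤ F x} σ ∧ ∀ y, F y ≤ F x → F y ≤ a → σ y = σ₀ y := by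
      intro x
      by_cases h : F x ∈ L
      · exact ⟨h.choose, fun _ => h.choose_spec⟩
      · exact ⟨σ₀, fun h' => absurd h' h⟩
    choose τ hτ using hex
    have hτL : ∀ x ∈ U, F x ∈ L := fun x hx => by
      obtain ⟨s, hs, hxs⟩ := hUL x hx
      exact hLdown s hs _ hxs.le
    -- The diagonal choice is continuous: by uniqueness, for `y` near `x` all the `τ y` agree at `y`
    -- with one section over a sublevel set that contains a neighbourhood of `x`.
    refine ⟨fun x => τ x x, ⟨fun x hx => ?_, fun x hx => (hτ x (hτL x hx)).1.2 x (le_refl (F x))⟩,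
      fun x hx hxa => (hτ x (hτL x hx)).2 x le_rfl hxa⟩
    obtain ⟨s, ⟨σ, hσ, hσa⟩, hxs⟩ := hUL x hx
    have hop : IsOpen (U ∩ {y | F y < s}) := hU.inter (isOpen_lt hF continuous_const)
    have hev : (fun y => τ y y) =ᶠ[𝓝 x] σ := by
      filter_upwards [hop.mem_nhds ⟨hx, hxs⟩] with y hy
      have hys : F y < s := hy.2
      obtain ⟨h1, h2⟩ := hτ y (hτL y hy.1)
      exact h1.eqOn_of_localDescent hψ hF hc hd'
        (hσ.mono fun z (hz : F z ≤ F y) => hz.trans hys.le)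
        (fun z hz hza => (h2 z hz hza).trans (hσa z (hz.trans hys.le) hza).symm) (le_refl (F y))
    have hσx : ContinuousAt σ x :=
      (hσ.1.mono fun y (hy : F y < s) => hy.le).continuousAt
        ((isOpen_lt hF continuous_const).mem_nhds hxs)
    exact (hσx.congr hev.symm).continuousWithinAt
  have hLuniv : ∀ s, s ∈ L := by
    by_contra! hne
    obtain ⟨s₁, hs₁⟩ := hne
    have hbdd : BddAbove L := ⟨s₁, fun t ht => not_lt.1 fun h => hs₁ (hLdown t ht _ h.le)⟩
    set s := sSup L
    have hsL : s ∈ L := by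
      -- Descent is available only above `a`; if the supremum is `a` itself, `σ₀` already does the
      -- job.
      rcases (le_csSup hbdd hLa).eq_or_lt with h | h
      · rwa [show s = a from h.symm]
      obtain ⟨σ, hσ, hσa⟩ := hglue {x | F x < s} (isOpen_lt hF continuous_const) fun x hx => by
        obtain ⟨t, ht, hxt⟩ := exists_lt_of_lt_csSup ⟨a, hLa⟩ hx
        exact ⟨t, ht, hxt⟩
      obtain ⟨τ, hτ, hτσ⟩ := hσ.exists_extend_closed hψ hF fun p hp => hd p (hp ▸ h)
      exact ⟨τ, hτ, fun x _ hxa => (hτσ (hxa.trans_lt h)).trans (hσa x (hxa.trans_lt h) hxa)⟩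
    obtain ⟨σ, hσ, hσa⟩ := hsL
    obtain ⟨ε, hε, τ, hτ, hτσ⟩ := hσ.exists_extend_open hψ hF hc
    have : s + ε ∈ L := by
      refine ⟨τ, hτ, fun x _ hxa => ?_⟩
      have hxs : F x ≤ s := hxa.trans (le_csSup hbdd hLa)
      exact (hτσ hxs).trans (hσa x hxs hxa)
    have := le_csSup hbdd this
    linarith
  obtain ⟨σ, hσ, hσa⟩ := hglue univ isOpen_univ fun x _ => ⟨F x + 1, hLuniv _, by linarith⟩
  exact ⟨σ, hσ, fun x hx => hσa x (mem_univ x) hx⟩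

end ExtendingSections

/-! ### Consequences of having a global section through every point. -/

section GlobalSections

open Set Filter Topology
open scoped Manifold ContDiff

theorem range_eq_setOf_section {X M : Type*} {ψ : M → X} {σ : X → M} (hσ : ∀ y, ψ (σ y) = y) :
    range σ = {x | σ (ψ x) = x} := by
  ext x
  constructor
  · rintro ⟨y, rfl⟩
    exact congrArg σ (hσ y)
  · intro h
    exact ⟨ψ x, h⟩

variable {X M : Type*} [TopologicalSpace X] [TopologicalSpace M] {ψ : M → X}

/-- Through each point of the source of `ψ` there is a continuous global section of `ψ`. -/
def HasGlobalSections (ψ : M → X) : Prop :=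
  ∀ x, ∃ σ : X → M, Continuous σ ∧ (∀ y, ψ (σ y) = y) ∧ σ (ψ x) = x

/-- The image is the locus where `σ ∘ ψ` and the identity agree. Both are lifts of `ψ` through `ψ`,
so this locus is closed by separatedness and open by local injectivity. -/
theorem isClopen_range_section [T2Space M] (hψ : IsLocalHomeomorph ψ) {σ : X → M}
    (hσ : Continuous σ) (hψσ : ∀ y, ψ (σ y) = y) : IsClopen (range σ) := by
  have he : ψ ∘ (σ ∘ ψ) = ψ ∘ id := funext fun x => hψσ (ψ x)
  rw [range_eq_setOf_section hψσ]
  exact ⟨(T2Space.isSeparatedMap ψ).isClosed_eqLocus (hσ.comp hψ.continuous) continuous_id he,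
    hψ.isLocallyInjective.isOpen_eqLocus (hσ.comp hψ.continuous) continuous_id he⟩

theorem connectedComponent_eq_range_section [T2Space M] [PreconnectedSpace X]
    (hψ : IsLocalHomeomorph ψ) {σ : X → M} (hσ : Continuous σ) (hψσ : ∀ y, ψ (σ y) = y) {x : M}
    (hx : σ (ψ x) = x) : connectedComponent x = range σ :=
  ((isClopen_range_section hψ hσ hψσ).connectedComponent_subset ⟨ψ x, hx⟩).antisymm
    ((isPreconnected_range hσ).subset_connectedComponent ⟨ψ x, hx⟩)

/-- Sections through two points of the same image coincide. Sending `m` to `ψ m` and to the value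
over `l` of the section through `m` therefore trivializes `ψ` over the whole of `X`; the second
coordinate is locally constant. -/
theorem HasGlobalSections.isCoveringMap [T2Space M] [PreconnectedSpace X]
    (hψ : IsLocalHomeomorph ψ) (h : HasGlobalSections ψ) : IsCoveringMap ψ := by
  choose τ hτc hτψ hτx using h
  have heq : ∀ m m', m' ∈ range (τ m) → τ m' = τ m := by
    rintro m m' ⟨y, hy⟩
    refine (T2Space.isSeparatedMap ψ).eq_of_comp_eq hψ.isLocallyInjective (hτc m') (hτc m)
      (funext fun y => (hτψ m' y).trans (hτψ m y).symm) (ψ m') ?_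
    rw [hτx, ← hy, hτψ]
  intro l
  have hdisc : DiscreteTopology (ψ ⁻¹' {l}) :=
    (discreteTopology_iff_locallyInjective l).2 (by
      have := hψ.isLocallyInjective.comp_right continuous_subtype_val
        (Subtype.val_injective : Function.Injective (Subtype.val : ψ ⁻¹' {l} → M))
      convert this using 1
      ext z
      exact z.2.symm)
  refine ⟨hdisc, univ, mem_univ l, isOpen_univ, isOpen_univ, ?_⟩
  have hcont : Continuous fun m => (⟨τ m l, hτψ m l⟩ : ψ ⁻¹' {l}) := by
    rw [continuous_iff_continuousAt]
    intro m
    have : (fun m => (⟨τ m l, hτψ m l⟩ : ψ ⁻¹' {l})) =ᶠ[𝓝 m] fun _ => ⟨τ m l, hτψ m l⟩ := by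
      filter_upwards [(isClopen_range_section hψ (hτc m) (hτψ m)).isOpen.mem_nhds
        ⟨ψ m, hτx m⟩] with m' hm'
      exact Subtype.ext (congrFun (heq m m' hm') l)
    exact continuousAt_const.congr this.symm
  let e : M ≃ₜ X × (ψ ⁻¹' {l}) :=
    { toFun := fun m => (ψ m, ⟨τ m l, hτψ m l⟩)
      invFun := fun p => τ p.2 p.1
      left_inv := fun m => by
        change τ (τ m l) (ψ m) = m
        rw [heq m _ ⟨l, rfl⟩, hτx]
      right_inv := by
        rintro ⟨y, z, hz⟩
        have hz : ψ z = l := hz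
        have h1 : τ (τ z y) = τ z := heq z _ ⟨y, rfl⟩
        refine Prod.ext (hτψ z y) (Subtype.ext ?_)
        change τ (τ z y) l = z
        rw [h1, ← hz, hτx]
      continuous_toFun := hψ.continuous.prodMk hcont
      continuous_invFun := continuous_prod_of_discrete_right.2 fun z => hτc z }
  refine ⟨(Homeomorph.Set.univ M).trans
    (e.trans ((Homeomorph.Set.univ X).symm.prodCongr (Homeomorph.refl _))), fun x => rfl⟩

/-- The image of `R` under the section through `x` is a connected subset of `ψ ⁻¹' R` containing
`x`, hence lies in the component, and it maps onto `R`. -/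
theorem HasGlobalSections.exceptionalSet_eq_empty (h : HasGlobalSections ψ) {R : Set X}
    (hR : IsPreconnected R) {x : M} (hx : x ∈ ψ ⁻¹' R) : exceptionalSet ψ R x = ∅ := by
  obtain ⟨σ, hσ, hψσ, hσx⟩ := h x
  refine sdiff_eq_empty.2 fun y hy => ⟨σ y, ?_, hψσ y⟩
  refine (hR.image σ hσ.continuousOn).subset_connectedComponentIn ⟨ψ x, hx, hσx⟩ ?_ ⟨y, hy, rfl⟩
  rintro _ ⟨z, hz, rfl⟩
  rw [mem_preimage, hψσ]
  exact hz

variable {E E' : Type*} [NormedAddCommGroup E] [NormedSpace ℝ E] [NormedAddCommGroup E']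
  [NormedSpace ℝ E'] {H H' : Type*} [TopologicalSpace H] [TopologicalSpace H']
  {I : ModelWithCorners ℝ E H} {J : ModelWithCorners ℝ E' H'} [ChartedSpace H M]
  [ChartedSpace H' X] {n : WithTop ℕ∞}

/-- By continuity, the section stays where the local inverse of `ψ` is defined, and coincides with
it there. -/
theorem IsLocalDiffeomorph.contMDiff_section (hψ : IsLocalDiffeomorph I J n ψ) {σ : X → M}
    (hσ : Continuous σ) (hψσ : ∀ y, ψ (σ y) = y) : ContMDiff J I n σ := by
  intro y
  have h := hψ (σ y)
  have h1 := h.localInverse_contMDiffAt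
  rw [hψσ] at h1
  refine h1.congr_of_eventuallyEq ?_
  filter_upwards [hσ.continuousAt.preimage_mem_nhds
    (h.localInverse.open_target.mem_nhds h.localInverse_mem_target)] with z hz
  have := h.localInverse_left_inv hz
  rw [hψσ] at this
  exact this.symm

theorem HasGlobalSections.exists_diffeomorph [T2Space M] [PreconnectedSpace X]
    (hψ : IsLocalDiffeomorph I J ∞ ψ) (h : HasGlobalSections ψ) (x : M) :
    ∃ U : TopologicalSpace.Opens M, (U : Set M) = connectedComponent x ∧
      ∃ Φ : U ≃ₘ^∞⟮I, J⟯ X, ∀ y : U, Φ y = ψ y := by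
  obtain ⟨σ, hσ, hψσ, hσx⟩ := h x
  let U : TopologicalSpace.Opens M :=
    ⟨range σ, (isClopen_range_section hψ.isLocalHomeomorph hσ hψσ).isOpen⟩
  refine ⟨U, (connectedComponent_eq_range_section hψ.isLocalHomeomorph hσ hψσ hσx).symm,
    { toFun := fun y => ψ y
      invFun := fun y => ⟨σ y, y, rfl⟩
      left_inv := ?_
      right_inv := hψσ
      contMDiff_toFun := hψ.contMDiff.comp contMDiff_subtype_val
      contMDiff_invFun := ?_ }, fun y => rfl⟩
  · rintro ⟨_, y, rfl⟩
    exact Subtype.ext (congrArg σ (hψσ y))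
  · exact (ContMDiff.subtypeVal_comp_iff U _).1 (hψ.contMDiff_section hσ hψσ)

end GlobalSections

/-! ### Avoiding countably many subspaces. -/

section Hyperplanes

/-- A countable family of proper subspaces of a finite-dimensional real vector space does not
cover a nonempty open set. -/
theorem exists_mem_forall_notMem_submodule {V : Type*} [NormedAddCommGroup V] [NormedSpace ℝ V]
    [FiniteDimensional ℝ V] {ι : Type*} [Countable ι] (K : ι → Submodule ℝ V)
    (hK : ∀ i, K i ≠ ⊤) {U : Set V} (hU : IsOpen U) (hne : U.Nonempty) :
    ∃ v ∈ U, ∀ i, v ∉ K i := by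
  have : CompleteSpace V := FiniteDimensional.complete ℝ V
  -- Baire: proper subspaces are closed and have empty interior.
  have hd : Dense (⋂ i, ((K i : Set V)ᶜ)) := by
    refine dense_iInter_of_isOpen (fun i => (K i).closed_of_finiteDimensional.isOpen_compl)
      fun i => ?_
    rw [← interior_eq_empty_iff_dense_compl, ← Set.not_nonempty_iff_eq_empty]
    exact fun h => hK i ((K i).eq_top_of_nonempty_interior' h)
  obtain ⟨v, hv, hvK⟩ := hd.inter_open_nonempty U hU hne
  exact ⟨v, hv, fun i => Set.mem_iInter.1 hvK i⟩

end Hyperplanes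

namespace BBFLattice

/-! ### Linear algebra of the real form of signature `(3, b - 3)`, and existence of generic
three-spaces. -/

section RealForm

variable {b : ℕ} (Λ : BBFLattice b)

theorem realForm_symm (x y : Fin b → ℝ) : Λ.form ℝ x y = Λ.form ℝ y x := by
  simp only [form, gramForm, Matrix.toBilin'_apply, Matrix.map_apply]
  rw [Finset.sum_comm]
  refine Finset.sum_congr rfl fun i _ => Finset.sum_congr rfl fun j _ => ?_
  rw [Λ.symm.apply i j]
  ring

theorem continuous_realForm_self : Continuous fun x : Fin b → ℝ => Λ.form ℝ x x := by
  simp only [form, gramForm, Matrix.toBilin'_apply]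
  fun_prop

/-- The two indices of the signature add up to the rank, which leaves no room for a radical. -/
theorem eq_zero_of_forall_form_eq_zero {x : Fin b → ℝ} (h : ∀ y, Λ.form ℝ x y = 0) : x = 0 := by
  have h1 := QuadraticForm.sigPos_add_sigNeg_add_radical
    (Q := (gramForm Λ.gram ℝ).toQuadraticMap)
  have hp : sigPos (gramForm Λ.gram ℝ).toQuadraticMap = 3 := Λ.sigPos_eq
  have hn : sigNeg (gramForm Λ.gram ℝ).toQuadraticMap + 3 = b := Λ.sigNeg_eq
  rw [hp, Module.finrank_fin_fun] at h1
  have h2 : Module.finrank ℝ (gramForm Λ.gram ℝ).toQuadraticMap.radical = 0 := by omega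
  rw [Submodule.finrank_eq_zero] at h2
  have h3 : x ∈ (gramForm Λ.gram ℝ).toQuadraticMap.radical := by
    rw [QuadraticMap.mem_radical_iff']
    have hx : ∀ y, gramForm Λ.gram ℝ x y = 0 := h
    have hx' : ∀ y, gramForm Λ.gram ℝ y x = 0 := fun y => (Λ.realForm_symm y x).trans (h y)
    simp [LinearMap.BilinMap.toQuadraticMap_apply, hx, hx']
  rwa [h2, Submodule.mem_bot] at h3

theorem finrank_le_three {W : Submodule ℝ (Fin b → ℝ)}
    (hW : ∀ w ∈ W, w ≠ 0 → 0 < Λ.form ℝ w w) : Module.finrank ℝ W ≤ 3 := by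
  rw [← Λ.sigPos_eq]
  refine le_sigPos_of_posDef _ fun w hw => ?_
  exact hW w w.2 fun h => hw (Subtype.ext h)

theorem exists_isPositiveThreeSpace : ∃ W, Λ.IsPositiveThreeSpace W := by
  obtain ⟨W, hW, hpos⟩ := exists_finrank_eq_sigPos_and_posDef
    (gramForm Λ.gram ℝ).toQuadraticMap
  refine ⟨W, hW.trans Λ.sigPos_eq, fun w hw h0 => ?_⟩
  exact hpos ⟨w, hw⟩ fun h => h0 (congrArg Subtype.val h)

theorem form_sum_smul_sum_smul {ι : Type*} [Fintype ι] {f : ι → Fin b → ℝ}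
    (hf : ∀ i j, i ≠ j → Λ.form ℝ (f i) (f j) = 0) (c : ι → ℝ) :
    Λ.form ℝ (∑ i, c i • f i) (∑ i, c i • f i) = ∑ i, c i ^ 2 * Λ.form ℝ (f i) (f i) := by
  classical
  simp only [map_sum, map_smul, LinearMap.sum_apply, LinearMap.smul_apply, smul_eq_mul]
  refine Finset.sum_congr rfl fun i _ => ?_
  rw [Finset.sum_eq_single i]
  · ring
  · intro j _ hj
    rw [hf j i hj]
    simp
  · simp

theorem linearIndependent_of_orthogonal {ι : Type*} [Fintype ι] {f : ι → Fin b → ℝ}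
    (hf : ∀ i j, i ≠ j → Λ.form ℝ (f i) (f j) = 0) (hpos : ∀ i, 0 < Λ.form ℝ (f i) (f i)) :
    LinearIndependent ℝ f :=
  LinearMap.linearIndependent_of_isOrthoᵢ (B := Λ.form ℝ) (fun i j hij => hf i j hij)
    fun i => (hpos i).ne'

theorem form_self_pos_of_mem_span {ι : Type*} [Fintype ι] {f : ι → Fin b → ℝ}
    (hf : ∀ i j, i ≠ j → Λ.form ℝ (f i) (f j) = 0) (hpos : ∀ i, 0 < Λ.form ℝ (f i) (f i)) :
    ∀ w ∈ Submodule.span ℝ (Set.range f), w ≠ 0 → 0 < Λ.form ℝ w w := by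
  intro w hw h0
  obtain ⟨c, rfl⟩ := (Submodule.mem_span_range_iff_exists_fun ℝ).1 hw
  rw [Λ.form_sum_smul_sum_smul hf]
  have hc : ∃ i, c i ≠ 0 := by
    by_contra! h
    exact h0 (by simp [h])
  obtain ⟨i, hi⟩ := hc
  exact Finset.sum_pos' (fun i _ => mul_nonneg (sq_nonneg _) (hpos i).le)
    ⟨i, Finset.mem_univ i, mul_pos (by positivity) (hpos i)⟩

theorem isPositiveThreeSpace_span {f : Fin 3 → Fin b → ℝ}
    (hf : ∀ i j, i ≠ j → Λ.form ℝ (f i) (f j) = 0) (hpos : ∀ i, 0 < Λ.form ℝ (f i) (f i)) :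
    Λ.IsPositiveThreeSpace (Submodule.span ℝ (Set.range f)) :=
  ⟨(finrank_span_eq_card (Λ.linearIndependent_of_orthogonal hf hpos)).trans (by simp),
    Λ.form_self_pos_of_mem_span hf hpos⟩

/-- `e` is a `q`-orthonormal triple. -/
def IsOrthonormal (e : Fin 3 → Fin b → ℝ) : Prop :=
  (∀ i j, i ≠ j → Λ.form ℝ (e i) (e j) = 0) ∧ ∀ i, Λ.form ℝ (e i) (e i) = 1

variable {Λ}

theorem IsOrthonormal.isPositiveThreeSpace {e : Fin 3 → Fin b → ℝ} (he : Λ.IsOrthonormal e) :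
    Λ.IsPositiveThreeSpace (Submodule.span ℝ (Set.range e)) :=
  Λ.isPositiveThreeSpace_span he.1 fun i => by rw [he.2 i]; exact one_pos

variable (Λ) in
/-- The orthogonal projection to the span of the orthonormal triple `e`. -/
noncomputable def proj (e : Fin 3 → Fin b → ℝ) (x : Fin b → ℝ) : Fin b → ℝ :=
  ∑ i, Λ.form ℝ (e i) x • e i

variable (Λ) in
theorem proj_mem (e : Fin 3 → Fin b → ℝ) (x : Fin b → ℝ) :
    Λ.proj e x ∈ Submodule.span ℝ (Set.range e) :=
  Submodule.sum_mem _ fun i _ => Submodule.smul_mem _ _ (Submodule.subset_span ⟨i, rfl⟩)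

theorem IsOrthonormal.form_proj {e : Fin 3 → Fin b → ℝ} (he : Λ.IsOrthonormal e)
    (x : Fin b → ℝ) (i : Fin 3) : Λ.form ℝ (e i) (Λ.proj e x) = Λ.form ℝ (e i) x := by
  simp only [proj, map_sum, map_smul, smul_eq_mul]
  rw [Finset.sum_eq_single i]
  · rw [he.2 i, mul_one]
  · intro j _ hj
    rw [he.1 i j hj.symm, mul_zero]
  · simp

theorem IsOrthonormal.form_sub_proj {e : Fin 3 → Fin b → ℝ} (he : Λ.IsOrthonormal e)
    (x : Fin b → ℝ) (i : Fin 3) : Λ.form ℝ (e i) (x - Λ.proj e x) = 0 := by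
  rw [map_sub, he.form_proj, sub_self]

/-- Pythagoras for the projection to the span. The second summand is never positive
(`IsOrthonormal.form_nonpos`), which is why the energy defined below is at least `1`. -/
theorem IsOrthonormal.form_self {e : Fin 3 → Fin b → ℝ} (he : Λ.IsOrthonormal e)
    (x : Fin b → ℝ) : Λ.form ℝ x x =
      ∑ i, Λ.form ℝ (e i) x ^ 2 + Λ.form ℝ (x - Λ.proj e x) (x - Λ.proj e x) := by
  have h1 : Λ.form ℝ (Λ.proj e x) (x - Λ.proj e x) = 0 := by
    conv_lhs => enter [1]; rw [proj]
    simp [-map_sub, he.form_sub_proj]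
  have h2 := h1
  rw [realForm_symm] at h2
  have h3 : Λ.form ℝ (Λ.proj e x) (Λ.proj e x) = ∑ i, Λ.form ℝ (e i) x ^ 2 := by
    rw [proj, Λ.form_sum_smul_sum_smul he.1]
    simp [he.2]
  have h4 : Λ.form ℝ x x = Λ.form ℝ (Λ.proj e x + (x - Λ.proj e x))
      (Λ.proj e x + (x - Λ.proj e x)) := by rw [add_sub_cancel]
  rw [h4, LinearMap.map_add₂, map_add, map_add, h1, h2, h3]
  ring

/-- Otherwise `u` and the triple would span a positive subspace of dimension four. -/
theorem IsOrthonormal.form_nonpos {e : Fin 3 → Fin b → ℝ} (he : Λ.IsOrthonormal e)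
    {u : Fin b → ℝ} (hu : ∀ i, Λ.form ℝ (e i) u = 0) : Λ.form ℝ u u ≤ 0 := by
  by_contra! h
  let f : Option (Fin 3) → Fin b → ℝ := fun o => o.elim u e
  have hf : ∀ i j, i ≠ j → Λ.form ℝ (f i) (f j) = 0 := by
    rintro (_ | i) (_ | j) hij
    · exact absurd rfl hij
    · exact (Λ.realForm_symm _ _).trans (hu j)
    · exact hu i
    · exact he.1 i j fun h => hij (congrArg some h)
  have hpos : ∀ i, 0 < Λ.form ℝ (f i) (f i) := by
    rintro (_ | i)
    · exact h
    · exact (he.2 i).symm ▸ one_pos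
  have h1 := Λ.finrank_le_three (Λ.form_self_pos_of_mem_span hf hpos)
  rw [finrank_span_eq_card (Λ.linearIndependent_of_orthogonal hf hpos)] at h1
  simp at h1

/-- An isotropic vector of a semidefinite space is orthogonal to that whole space. Here it is also
orthogonal to the triple, so nondegeneracy kills it. -/
theorem IsOrthonormal.form_neg {e : Fin 3 → Fin b → ℝ} (he : Λ.IsOrthonormal e)
    {u : Fin b → ℝ} (hu : ∀ i, Λ.form ℝ (e i) u = 0) (h0 : u ≠ 0) : Λ.form ℝ u u < 0 := by
  refine (he.form_nonpos hu).lt_of_ne fun huu => h0 ?_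
  refine Λ.eq_zero_of_forall_form_eq_zero fun y => ?_
  have key : ∀ z, (∀ i, Λ.form ℝ (e i) z = 0) → Λ.form ℝ u z = 0 := by
    intro z hz
    by_contra hne
    have h1 : ∀ t : ℝ, 2 * t * Λ.form ℝ u z + Λ.form ℝ z z ≤ 0 := by
      intro t
      have h2 := he.form_nonpos (u := t • u + z) fun i => by
        rw [map_add, map_smul, hu, hz, smul_zero, add_zero]
      simp only [map_add, map_smul, LinearMap.add_apply, LinearMap.smul_apply, smul_eq_mul, huu,
        Λ.realForm_symm z u] at h2
      linarith
    -- This `t` makes the left side of `h1` equal to `1`.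
    have h3 := h1 ((1 - Λ.form ℝ z z) / (2 * Λ.form ℝ u z))
    have h4 : 2 * ((1 - Λ.form ℝ z z) / (2 * Λ.form ℝ u z)) * Λ.form ℝ u z =
        1 - Λ.form ℝ z z := by field_simp
    rw [h4] at h3
    linarith
  have h1 := key (y - Λ.proj e y) (he.form_sub_proj y)
  rw [map_sub, sub_eq_zero] at h1
  rw [h1, proj]
  simp [Λ.realForm_symm u, hu]

theorem IsOrthonormal.form_self_le {e : Fin 3 → Fin b → ℝ} (he : Λ.IsOrthonormal e)
    (x : Fin b → ℝ) : Λ.form ℝ x x ≤ ∑ i, Λ.form ℝ (e i) x ^ 2 := by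
  have := he.form_nonpos (he.form_sub_proj x)
  rw [he.form_self]
  linarith

theorem IsOrthonormal.mem_span_of_form_self_ge {e : Fin 3 → Fin b → ℝ} (he : Λ.IsOrthonormal e)
    {x : Fin b → ℝ} (h : ∑ i, Λ.form ℝ (e i) x ^ 2 ≤ Λ.form ℝ x x) :
    x ∈ Submodule.span ℝ (Set.range e) := by
  have h1 : x - Λ.proj e x = 0 := by
    by_contra hne
    have := he.form_neg (he.form_sub_proj x) hne
    rw [he.form_self] at h
    linarith
  rw [sub_eq_zero.1 h1]
  exact Λ.proj_mem e x

theorem IsOrthonormal.eq_proj {e : Fin 3 → Fin b → ℝ} (he : Λ.IsOrthonormal e)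
    {x : Fin b → ℝ} (hx : x ∈ Submodule.span ℝ (Set.range e)) : Λ.proj e x = x := by
  obtain ⟨c, rfl⟩ := (Submodule.mem_span_range_iff_exists_fun ℝ).1 hx
  have h : ∀ i, Λ.form ℝ (e i) (∑ j, c j • e j) = c i := by
    intro i
    simp only [map_sum, map_smul, smul_eq_mul]
    rw [Finset.sum_eq_single i]
    · rw [he.2 i, mul_one]
    · intro j _ hj
      rw [he.1 i j hj.symm, mul_zero]
    · simp
  simp only [proj, h]

theorem IsOrthonormal.form_self_of_mem {e : Fin 3 → Fin b → ℝ} (he : Λ.IsOrthonormal e)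
    {x : Fin b → ℝ} (hx : x ∈ Submodule.span ℝ (Set.range e)) :
    Λ.form ℝ x x = ∑ i, Λ.form ℝ (e i) x ^ 2 := by
  rw [he.form_self, he.eq_proj hx]
  simp

variable (Λ)

/-- The orthogonal complement of `x` and `y` in `H ⊗ ℝ`. -/
noncomputable def perp (x y : Fin b → ℝ) : Submodule ℝ (Fin b → ℝ) :=
  LinearMap.ker ((Λ.form ℝ x).prod (Λ.form ℝ y))

theorem mem_perp {x y w : Fin b → ℝ} :
    w ∈ Λ.perp x y ↔ Λ.form ℝ x w = 0 ∧ Λ.form ℝ y w = 0 := by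
  simp [perp, LinearMap.mem_ker]

/-- Two linear conditions cannot exhaust three dimensions. -/
theorem exists_mem_inf_perp {W : Submodule ℝ (Fin b → ℝ)} (hW : Λ.IsPositiveThreeSpace W)
    (x y : Fin b → ℝ) : ∃ w ∈ W, w ∈ Λ.perp x y ∧ 0 < Λ.form ℝ w w := by
  have h : LinearMap.ker (((Λ.form ℝ x).prod (Λ.form ℝ y)).domRestrict W) ≠ ⊥ := by
    apply LinearMap.ker_ne_bot_of_finrank_lt
    rw [hW.1]
    simp
  obtain ⟨⟨w, hwW⟩, hw, hw0⟩ := Submodule.exists_mem_ne_zero_of_ne_bot h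
  exact ⟨w, hwW, hw, hW.2 w hwW fun h => hw0 (Subtype.ext h)⟩

theorem sub_mem_perp {x y : Fin b → ℝ} (hx : 0 < Λ.form ℝ x x) (hxy : Λ.form ℝ y y = Λ.form ℝ x x)
    (h0 : Λ.form ℝ x y = 0) (u : Fin b → ℝ) :
    u - (Λ.form ℝ x u / Λ.form ℝ x x) • x - (Λ.form ℝ y u / Λ.form ℝ x x) • y ∈ Λ.perp x y := by
  have h0' : Λ.form ℝ y x = 0 := (Λ.realForm_symm y x).trans h0
  rw [mem_perp]
  simp only [map_sub, map_smul, smul_eq_mul, h0, h0', hxy]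
  constructor <;> field_simp <;> ring

/-- The double orthogonal complement of a positive plane is the plane: the component of `z` in the
complement is orthogonal to the plane and to the complement, hence to everything. -/
theorem mem_span_pair_of_forall_perp {x y : Fin b → ℝ} (hx : 0 < Λ.form ℝ x x)
    (hxy : Λ.form ℝ y y = Λ.form ℝ x x) (h0 : Λ.form ℝ x y = 0) {z : Fin b → ℝ}
    (hz : ∀ w ∈ Λ.perp x y, Λ.form ℝ w z = 0) : z ∈ Submodule.span ℝ {x, y} := by
  have h1 := Λ.sub_mem_perp hx hxy h0 z
  set z' := z - (Λ.form ℝ x z / Λ.form ℝ x x) • x - (Λ.form ℝ y z / Λ.form ℝ x x) • y with hz'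
  have hz0 : z' = 0 := by
    refine Λ.eq_zero_of_forall_form_eq_zero fun u => ?_
    have h2 := Λ.sub_mem_perp hx hxy h0 u
    have h3 := Λ.mem_perp.1 h1
    rw [Λ.realForm_symm x, Λ.realForm_symm y] at h3
    have h4 := hz _ h2
    have h5 := Λ.mem_perp.1 h2
    set u' := u - (Λ.form ℝ x u / Λ.form ℝ x x) • x - (Λ.form ℝ y u / Λ.form ℝ x x) • y with hu'
    have hu : u = u' + (Λ.form ℝ x u / Λ.form ℝ x x) • x + (Λ.form ℝ y u / Λ.form ℝ x x) • y := by
      rw [hu']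
      module
    have h6 : Λ.form ℝ z' u' = 0 := by
      rw [hz', LinearMap.map_sub₂, LinearMap.map_sub₂, LinearMap.map_smul₂, LinearMap.map_smul₂,
        h5.1, h5.2, Λ.realForm_symm z u', h4]
      simp
    rw [hu, map_add, map_add, map_smul, map_smul, h3.1, h3.2, h6]
    simp
  rw [Submodule.mem_span_pair]
  refine ⟨Λ.form ℝ x z / Λ.form ℝ x x, Λ.form ℝ y z / Λ.form ℝ x x, ?_⟩
  have : z = z' + (Λ.form ℝ x z / Λ.form ℝ x x) • x + (Λ.form ℝ y z / Λ.form ℝ x x) • y := by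
    rw [hz']
    module
  rw [hz0, zero_add] at this
  exact this.symm

theorem orthogonal_triple {x y w : Fin b → ℝ} (h0 : Λ.form ℝ x y = 0) (hw : w ∈ Λ.perp x y) :
    ∀ i j, i ≠ j → Λ.form ℝ ((![x, y, w] : Fin 3 → Fin b → ℝ) i)
      ((![x, y, w] : Fin 3 → Fin b → ℝ) j) = 0 := by
  have h0' : Λ.form ℝ y x = 0 := (Λ.realForm_symm y x).trans h0
  obtain ⟨h1, h2⟩ := Λ.mem_perp.1 hw
  have h1' : Λ.form ℝ w x = 0 := (Λ.realForm_symm w x).trans h1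
  have h2' : Λ.form ℝ w y = 0 := (Λ.realForm_symm w y).trans h2
  intro i j hij
  fin_cases i <;> fin_cases j <;> simp_all

/-- A positive plane is contained in a generic positive three-space; its third direction can be
chosen outside of a given subspace. -/
theorem exists_isGHK {x y : Fin b → ℝ} (hx : 0 < Λ.form ℝ x x)
    (hxy : Λ.form ℝ y y = Λ.form ℝ x x) (h0 : Λ.form ℝ x y = 0) {Z : Submodule ℝ (Fin b → ℝ)}
    (hZ : ∃ w ∈ Λ.perp x y, w ∉ Z) :
    ∃ w ∈ Λ.perp x y, 0 < Λ.form ℝ w w ∧ w ∉ Z ∧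
      Λ.IsGHK (Submodule.span ℝ (Set.range (![x, y, w] : Fin 3 → Fin b → ℝ))) := by
  let P := Λ.perp x y
  let R (r : Fin b → ℚ) : Fin b → ℝ := fun i => (r i : ℝ)
  -- `none` stands for `Z`; the other indices are the rational vectors that do not annihilate `P`,
  -- so that each of them cuts out a proper hyperplane of `P`.
  let ι := Option {r : Fin b → ℚ // ∃ w ∈ P, Λ.form ℝ (R r) w ≠ 0}
  let K : ι → Submodule ℝ P := fun o =>
    o.elim (Z.comap P.subtype) fun r => LinearMap.ker ((Λ.form ℝ (R r)).domRestrict P)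
  have hK : ∀ i, K i ≠ ⊤ := by
    rintro (_ | ⟨r, w, hw, hrw⟩) h
    · obtain ⟨w, hw, hwZ⟩ := hZ
      have : (⟨w, hw⟩ : P) ∈ Z.comap P.subtype := (Submodule.eq_top_iff'.1 h) _
      exact hwZ this
    · have : (⟨w, hw⟩ : P) ∈ LinearMap.ker ((Λ.form ℝ (R r)).domRestrict P) :=
        (Submodule.eq_top_iff'.1 h) _
      exact hrw this
  obtain ⟨W, hW⟩ := Λ.exists_isPositiveThreeSpace
  obtain ⟨w₀, -, hw₀, hw₀p⟩ := Λ.exists_mem_inf_perp hW x y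
  obtain ⟨⟨w, hwP⟩, hwpos, hwK⟩ := exists_mem_forall_notMem_submodule K hK
    (U := {w : P | 0 < Λ.form ℝ w w})
    (isOpen_lt continuous_const (Λ.continuous_realForm_self.comp continuous_subtype_val))
    ⟨⟨w₀, hw₀⟩, hw₀p⟩
  have hwpos : 0 < Λ.form ℝ w w := hwpos
  refine ⟨w, hwP, hwpos, hwK none, Λ.isPositiveThreeSpace_span (Λ.orthogonal_triple h0 hwP) ?_, ?_⟩
  · intro i
    fin_cases i
    · exact hx
    · exact hxy.symm ▸ hx
    · exact hwpos
  · intro r hr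
    have hmem : ∀ i, (![x, y, w] : Fin 3 → Fin b → ℝ) i ∈
        Submodule.span ℝ (Set.range (![x, y, w] : Fin 3 → Fin b → ℝ)) := fun i =>
      Submodule.subset_span ⟨i, rfl⟩
    have hrx : Λ.form ℝ x (R r) = 0 := (Λ.realForm_symm _ _).trans (hr _ (hmem 0))
    have hry : Λ.form ℝ y (R r) = 0 := (Λ.realForm_symm _ _).trans (hr _ (hmem 1))
    have hrw : Λ.form ℝ (R r) w = 0 := hr _ (hmem 2)
    have hrP : ∀ w ∈ P, Λ.form ℝ (R r) w = 0 := by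
      by_contra! h
      exact hwK (some ⟨r, h⟩) hrw
    -- A rational vector that annihilates `P` lies in the plane of `x` and `y`; being also
    -- orthogonal to this positive plane, it is zero.
    have hR : R r = 0 := by
      obtain ⟨c, d, hcd⟩ := Submodule.mem_span_pair.1
        (Λ.mem_span_pair_of_forall_perp hx hxy h0 (z := R r) fun w hw =>
          (Λ.realForm_symm _ _).trans (hrP w hw))
      have h0' : Λ.form ℝ y x = 0 := (Λ.realForm_symm y x).trans h0
      rw [← hcd, map_add, map_smul, map_smul] at hrx hry
      simp only [h0, h0', smul_eq_mul, mul_zero, add_zero, zero_add, hxy, mul_eq_zero, hx.ne',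
        or_false] at hrx hry
      rw [← hcd, hrx, hry]
      simp
    ext i
    have hi : ((r i : ℚ) : ℝ) = 0 := congrFun hR i
    exact_mod_cast hi

end RealForm

end BBFLattice

namespace BBFLattice

/-! ### Real and imaginary parts, and the topology of the period space. -/

section ComplexForm

open Set Filter Topology

variable {b : ℕ}

/-- The real part of a vector of `H ⊗ ℂ`. -/
def reVec (v : Fin b → ℂ) : Fin b → ℝ := fun i => (v i).re

/-- The imaginary part of a vector of `H ⊗ ℂ`. -/
def imVec (v : Fin b → ℂ) : Fin b → ℝ := fun i => (v i).im

/-- The inclusion of `H ⊗ ℝ` in `H ⊗ ℂ`. -/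
def ofRealVec (x : Fin b → ℝ) : Fin b → ℂ := fun i => (x i : ℂ)

@[simp] theorem reVec_ofRealVec (x : Fin b → ℝ) : reVec (ofRealVec x) = x := rfl

@[simp] theorem imVec_ofRealVec (x : Fin b → ℝ) : imVec (ofRealVec x) = 0 := rfl

@[simp] theorem reVec_star (v : Fin b → ℂ) : reVec (star v) = reVec v := rfl

@[simp] theorem imVec_star (v : Fin b → ℂ) : imVec (star v) = -imVec v := rfl

@[simp] theorem star_ofRealVec (x : Fin b → ℝ) : star (ofRealVec x) = ofRealVec x := by
  ext i
  simp [ofRealVec]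

theorem reVec_smul (a : ℂ) (v : Fin b → ℂ) :
    reVec (a • v) = a.re • reVec v - a.im • imVec v := by
  ext i
  simp [reVec, imVec]

theorem imVec_smul (a : ℂ) (v : Fin b → ℂ) :
    imVec (a • v) = a.re • imVec v + a.im • reVec v := by
  ext i
  simp [reVec, imVec]

/-- The complexification of a subspace of `H ⊗ ℝ`. -/
def cplx (W : Submodule ℝ (Fin b → ℝ)) : Submodule ℂ (Fin b → ℂ) where
  carrier := {v | reVec v ∈ W ∧ imVec v ∈ W}
  zero_mem' := ⟨W.zero_mem, W.zero_mem⟩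
  add_mem' {v w} hv hw := ⟨W.add_mem hv.1 hw.1, W.add_mem hv.2 hw.2⟩
  smul_mem' a v hv := by
    refine ⟨?_, ?_⟩
    · rw [reVec_smul]
      exact W.sub_mem (W.smul_mem _ hv.1) (W.smul_mem _ hv.2)
    · rw [imVec_smul]
      exact W.add_mem (W.smul_mem _ hv.2) (W.smul_mem _ hv.1)

theorem mem_cplx {W : Submodule ℝ (Fin b → ℝ)} {v : Fin b → ℂ} :
    v ∈ cplx W ↔ reVec v ∈ W ∧ imVec v ∈ W := Iff.rfl

theorem star_mem_cplx {W : Submodule ℝ (Fin b → ℝ)} {v : Fin b → ℂ} (hv : v ∈ cplx W) :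
    star v ∈ cplx W := ⟨hv.1, W.neg_mem hv.2⟩

theorem ofRealVec_mem_cplx {W : Submodule ℝ (Fin b → ℝ)} {x : Fin b → ℝ} (hx : x ∈ W) :
    ofRealVec x ∈ cplx W := ⟨hx, W.zero_mem⟩

variable (Λ : BBFLattice b)

theorem form_re (v w : Fin b → ℂ) : (Λ.form ℂ v w).re =
    Λ.form ℝ (reVec v) (reVec w) - Λ.form ℝ (imVec v) (imVec w) := by
  simp only [form, gramForm, Matrix.toBilin'_apply, Matrix.map_apply, Complex.re_sum,
    ← Finset.sum_sub_distrib, reVec, imVec]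
  refine Finset.sum_congr rfl fun i _ => Finset.sum_congr rfl fun j _ => ?_
  simp

theorem form_im (v w : Fin b → ℂ) : (Λ.form ℂ v w).im =
    Λ.form ℝ (reVec v) (imVec w) + Λ.form ℝ (imVec v) (reVec w) := by
  simp only [form, gramForm, Matrix.toBilin'_apply, Matrix.map_apply, Complex.im_sum,
    ← Finset.sum_add_distrib, reVec, imVec]
  refine Finset.sum_congr rfl fun i _ => Finset.sum_congr rfl fun j _ => ?_
  simp

theorem form_ofRealVec (x y : Fin b → ℝ) :
    Λ.form ℂ (ofRealVec x) (ofRealVec y) = (Λ.form ℝ x y : ℂ) := by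
  apply Complex.ext <;> simp [form_re, form_im]

theorem form_ofRealVec_left (x : Fin b → ℝ) (v : Fin b → ℂ) :
    Λ.form ℂ (ofRealVec x) v = ⟨Λ.form ℝ x (reVec v), Λ.form ℝ x (imVec v)⟩ := by
  apply Complex.ext <;> simp [form_re, form_im]

/-- The hermitian square `q(v, conj v)`. -/
noncomputable def hermSq (v : Fin b → ℂ) : ℝ := (Λ.form ℂ v (star v)).re

theorem hermSq_eq (v : Fin b → ℂ) : Λ.hermSq v =
    Λ.form ℝ (reVec v) (reVec v) + Λ.form ℝ (imVec v) (imVec v) := by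
  simp [hermSq, form_re]

theorem form_star_self (v : Fin b → ℂ) : Λ.form ℂ v (star v) = (Λ.hermSq v : ℂ) := by
  apply Complex.ext
  · simp [hermSq]
  · simp [form_im, Λ.realForm_symm (reVec v) (imVec v)]

theorem hermSq_smul (a : ℂ) (v : Fin b → ℂ) :
    Λ.hermSq (a • v) = Complex.normSq a * Λ.hermSq v := by
  rw [hermSq_eq, hermSq_eq, reVec_smul, imVec_smul, Complex.normSq_apply]
  simp only [map_add, map_sub, map_smul, LinearMap.add_apply, LinearMap.sub_apply,
    LinearMap.smul_apply, smul_eq_mul, Λ.realForm_symm (imVec v) (reVec v)]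
  ring

theorem form_self_eq_zero_iff (v : Fin b → ℂ) : Λ.form ℂ v v = 0 ↔
    Λ.form ℝ (imVec v) (imVec v) = Λ.form ℝ (reVec v) (reVec v) ∧
      Λ.form ℝ (reVec v) (imVec v) = 0 := by
  rw [Complex.ext_iff, form_re, form_im, Λ.realForm_symm (imVec v) (reVec v)]
  simp only [Complex.zero_re, Complex.zero_im]
  constructor <;> rintro ⟨h1, h2⟩ <;> constructor <;> linarith

theorem ne_zero_of_hermSq_pos {v : Fin b → ℂ} (h : 0 < Λ.hermSq v) : v ≠ 0 := by
  rintro rfl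
  simp [hermSq] at h

/-- The period of an isotropic positive vector. -/
noncomputable def toPer (v : Fin b → ℂ) (h0 : Λ.form ℂ v v = 0) (h1 : 0 < Λ.hermSq v) : Λ.Per :=
  ⟨Projectivization.mk ℂ v (Λ.ne_zero_of_hermSq_pos h1), (Λ.mk_mem_periodDomain _ _).2 ⟨h0, h1⟩⟩

theorem continuous_toPer {α : Type*} [TopologicalSpace α] {f : α → Fin b → ℂ} (hf : Continuous f)
    (h0 : ∀ a, Λ.form ℂ (f a) (f a) = 0) (h1 : ∀ a, 0 < Λ.hermSq (f a)) :
    Continuous fun a => Λ.toPer (f a) (h0 a) (h1 a) := by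
  refine Continuous.subtype_mk ?_ _
  have h : Continuous fun a => (⟨f a, Λ.ne_zero_of_hermSq_pos (h1 a)⟩ : {v : Fin b → ℂ // v ≠ 0}) :=
    hf.subtype_mk _
  exact continuous_coinduced_rng.comp h

theorem toPer_rep (l : Λ.Per) : Λ.toPer l.1.rep l.2.1 l.2.2 = l :=
  Subtype.ext (Projectivization.mk_rep l.1)

theorem exists_rep_toPer {v : Fin b → ℂ} (h0 : Λ.form ℂ v v = 0) (h1 : 0 < Λ.hermSq v) :
    ∃ a : ℂ, a ≠ 0 ∧ (Λ.toPer v h0 h1).1.rep = a • v :=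
  exists_rep_mk v _

theorem toPer_smul {v : Fin b → ℂ} (h0 : Λ.form ℂ v v = 0) (h1 : 0 < Λ.hermSq v) {a : ℂ}
    (h0' : Λ.form ℂ (a • v) (a • v) = 0) (h1' : 0 < Λ.hermSq (a • v)) :
    Λ.toPer (a • v) h0' h1' = Λ.toPer v h0 h1 :=
  Subtype.ext ((Projectivization.mk_eq_mk_iff' ℂ _ _ _ _).2 ⟨a, rfl⟩)

theorem mem_hkLine_iff {W : Submodule ℝ (Fin b → ℝ)} {l : Λ.Per} :
    l ∈ Λ.hkLine W ↔ l.1.rep ∈ cplx W := by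
  change Submodule.span ℝ {reVec l.1.rep, imVec l.1.rep} ≤ W ↔ _
  rw [Submodule.span_le, Set.insert_subset_iff, Set.singleton_subset_iff]
  rfl

theorem toPer_mem_hkLine_iff {W : Submodule ℝ (Fin b → ℝ)} {v : Fin b → ℂ}
    (h0 : Λ.form ℂ v v = 0) (h1 : 0 < Λ.hermSq v) :
    Λ.toPer v h0 h1 ∈ Λ.hkLine W ↔ v ∈ cplx W := by
  obtain ⟨a, ha, h⟩ := Λ.exists_rep_toPer h0 h1
  rw [mem_hkLine_iff, h, Submodule.smul_mem_iff _ ha]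

theorem contDiff_re_form (w : Fin b → ℂ) : ContDiff ℝ ∞ fun v => (Λ.form ℂ w v).re :=
  Complex.reCLM.contDiff.comp (Λ.contDiff_form_right w)

theorem contDiff_im_form (w : Fin b → ℂ) : ContDiff ℝ ∞ fun v => (Λ.form ℂ w v).im :=
  Complex.imCLM.contDiff.comp (Λ.contDiff_form_right w)

theorem contDiff_hermSq : ContDiff ℝ ∞ (Λ.hermSq : (Fin b → ℂ) → ℝ) := by
  have hre : ∀ i, ContDiff ℝ ∞ fun v : Fin b → ℂ => (v i).re := fun i =>
    Complex.reCLM.contDiff.comp (contDiff_apply ℝ ℂ i)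
  have him : ∀ i, ContDiff ℝ ∞ fun v : Fin b → ℂ => (v i).im := fun i =>
    Complex.imCLM.contDiff.comp (contDiff_apply ℝ ℂ i)
  have : (Λ.hermSq : (Fin b → ℂ) → ℝ) = fun v =>
      Λ.form ℝ (reVec v) (reVec v) + Λ.form ℝ (imVec v) (imVec v) := funext Λ.hermSq_eq
  rw [this]
  simp only [form, gramForm, Matrix.toBilin'_apply, reVec, imVec]
  fun_prop

/-- The representative of `l` which is normalized with respect to the chart at `l₀`. -/
noncomputable def localRep (l₀ l : Λ.Per) : Fin b → ℂ := Λ.lift l₀ (Λ.chart l₀ l)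

theorem localRep_eq {l₀ l : Λ.Per} (hl : l ∈ (Λ.chart l₀).source) :
    ∃ a : ℂ, a ≠ 0 ∧ Λ.localRep l₀ l = a • l.1.rep := by
  have hl' : Λ.form ℂ (star (Λ.base l₀)) l.1.rep ≠ 0 := hl
  refine ⟨Λ.baseNorm l₀ / Λ.form ℂ (star (Λ.base l₀)) l.1.rep,
    div_ne_zero (Λ.baseNorm_ne_zero l₀) hl', ?_⟩
  change Λ.lift l₀ (Λ.chartVec l₀ l.1.rep) = _
  rw [chartVec, ← map_smul]
  apply lift_coord
  · have h0 : Λ.form ℂ l.1.rep l.1.rep = 0 := l.2.1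
    simp [h0]
  · rw [map_smul, smul_eq_mul, div_mul_cancel₀ _ hl']

theorem self_mem_chart_source (l : Λ.Per) : l ∈ (Λ.chart l).source :=
  mem_chart_source (Fin (b - 2) → ℂ) l

theorem chart_self (l : Λ.Per) : Λ.chart l l = 0 := by
  apply Λ.incl_injective l
  change Λ.incl l (Λ.chartVec l (Λ.base l)) = _
  have h : Λ.incl l (Λ.coord l (Λ.base l)) = 0 := by
    rw [incl_coord, starBase_base, base_base, inv_mul_cancel₀ (Λ.baseNorm_ne_zero l)]
    simp
  rw [chartVec, map_smul, h, smul_zero, map_zero]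

theorem exists_chart_symm_rep {l₀ : Λ.Per} {u : Fin (b - 2) → ℂ} (hu : u ∈ (Λ.chart l₀).target) :
    ∃ a : ℂ, a ≠ 0 ∧ ((Λ.chart l₀).symm u).1.rep = a • Λ.lift l₀ u := by
  have hu1 : 0 < (Λ.form ℂ (Λ.lift l₀ u) (star (Λ.lift l₀ u))).re := hu
  have hs : ((Λ.chart l₀).symm u).1 =
      Projectivization.mk ℂ (Λ.lift l₀ u) (Λ.lift_ne_zero l₀ u) := by
    change (dite _ _ _ : Λ.Per).1 = _
    rw [dif_pos hu1]
  rw [hs]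
  exact exists_rep_mk _ _

/-- A function on the period space is continuous if it is given by a continuous scale-invariant
function of the representatives. -/
theorem continuous_of_rep {Y : Type*} [TopologicalSpace Y] {f : (Fin b → ℂ) → Y}
    (hf : ∀ v, 0 < Λ.hermSq v → ContinuousAt f v)
    (hs : ∀ (a : ℂ) v, a ≠ 0 → f (a • v) = f v) :
    Continuous fun l : Λ.Per => f l.1.rep := by
  rw [continuous_iff_continuousAt]
  intro l₀
  have hsrc := (Λ.chart l₀).open_source.mem_nhds (Λ.self_mem_chart_source l₀)
  have hpos : 0 < Λ.hermSq (Λ.localRep l₀ l₀) := by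
    obtain ⟨a, ha, h⟩ := Λ.localRep_eq (Λ.self_mem_chart_source l₀)
    rw [h, hermSq_smul]
    exact mul_pos (Complex.normSq_pos.2 ha) l₀.2.2
  -- The chosen representative `rep` need not vary continuously; `localRep` does, and differs from
  -- it only by a nonzero scalar.
  have h1 : ContinuousAt (Λ.localRep l₀) l₀ :=
    (Λ.contDiff_lift l₀).continuous.continuousAt.comp
      ((Λ.chart l₀).continuousAt (Λ.self_mem_chart_source l₀))
  refine ((hf _ hpos).comp h1).congr ?_
  filter_upwards [hsrc] with l hl
  obtain ⟨a, ha, h⟩ := Λ.localRep_eq hl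
  rw [Function.comp_apply, h, hs a _ ha]

/-- The matrix `v v* / q(v, conj v)` does not depend on the scaling of `v` and determines its line,
so it embeds the period space continuously and injectively in a Hausdorff space. -/
instance : T2Space Λ.Per := by
  let f : (Fin b → ℂ) → Fin b → Fin b → ℂ := fun v i j => v i * star (v j) / (Λ.hermSq v : ℂ)
  have hf : Continuous fun l : Λ.Per => f l.1.rep := by
    refine Λ.continuous_of_rep (fun v hv => ?_) fun a v ha => ?_
    · have hc : Continuous fun v : Fin b → ℂ => ((Λ.hermSq v : ℝ) : ℂ) :=
        Complex.continuous_ofReal.comp Λ.contDiff_hermSq.continuous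
      refine continuousAt_pi.2 fun i => continuousAt_pi.2 fun j => ?_
      refine ContinuousAt.div (by fun_prop) hc.continuousAt ?_
      exact_mod_cast hv.ne'
    · ext i j
      have h1 : (Complex.normSq a : ℂ) ≠ 0 := by
        exact_mod_cast (Complex.normSq_pos.2 ha).ne'
      have h2 : a * (starRingEnd ℂ) a = (Complex.normSq a : ℂ) := Complex.mul_conj a
      simp only [f, hermSq_smul, Pi.smul_apply, smul_eq_mul, Complex.ofReal_mul,
        Complex.star_def, map_mul]
      rw [← mul_div_mul_left (v i * _) _ h1, ← h2]
      ring
  refine T2Space.of_injective_continuous (f := fun l : Λ.Per => f l.1.rep) ?_ hf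
  intro l l' h
  have h : f l.1.rep = f l'.1.rep := h
  have hl : (Λ.hermSq l.1.rep : ℂ) ≠ 0 := by exact_mod_cast (ne_of_gt l.2.2)
  have hl' : (Λ.hermSq l'.1.rep : ℂ) ≠ 0 := by exact_mod_cast (ne_of_gt l'.2.2)
  obtain ⟨j, hj⟩ : ∃ j, l.1.rep j ≠ 0 := by
    by_contra! h0
    exact l.1.rep_nonzero (funext h0)
  have hj' : star (l.1.rep j) ≠ 0 := star_ne_zero.2 hj
  have key : l.1.rep = (Λ.hermSq l.1.rep / Λ.hermSq l'.1.rep * star (l'.1.rep j) /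
      star (l.1.rep j)) • l'.1.rep := by
    ext i
    have hi : l.1.rep i * star (l.1.rep j) / (Λ.hermSq l.1.rep : ℂ) =
      l'.1.rep i * star (l'.1.rep j) / (Λ.hermSq l'.1.rep : ℂ) := congrFun (congrFun h i) j
    rw [Pi.smul_apply, smul_eq_mul]
    field_simp at hi ⊢
    linear_combination hi
  apply Subtype.ext
  rw [← l.1.mk_rep, ← l'.1.mk_rep]
  exact (Projectivization.mk_eq_mk_iff' ℂ _ _ _ _).2 ⟨_, key.symm⟩

end ComplexForm

end BBFLattice

namespace BBFLattice

/-! ### The exhaustion function attached to a positive three-space, and its minimum locus. -/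

section Energy

open Set Filter Topology

variable {b : ℕ} (Λ : BBFLattice b) (e : Fin 3 → Fin b → ℝ)

/-- The hermitian square of the projection of `v` to the complexified span of `e`. -/
noncomputable def projSq (v : Fin b → ℂ) : ℝ :=
  ∑ i, ((Λ.form ℂ (ofRealVec (e i)) v).re ^ 2 + (Λ.form ℂ (ofRealVec (e i)) v).im ^ 2)

theorem projSq_eq (v : Fin b → ℂ) : Λ.projSq e v =
    ∑ i, Λ.form ℝ (e i) (reVec v) ^ 2 + ∑ i, Λ.form ℝ (e i) (imVec v) ^ 2 := by
  simp only [projSq, form_ofRealVec_left, Finset.sum_add_distrib]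

theorem projSq_smul (a : ℂ) (v : Fin b → ℂ) :
    Λ.projSq e (a • v) = Complex.normSq a * Λ.projSq e v := by
  simp only [projSq, map_smul, smul_eq_mul, Finset.mul_sum, Complex.mul_re, Complex.mul_im,
    Complex.normSq_apply]
  refine Finset.sum_congr rfl fun i _ => ?_
  ring

theorem contDiff_projSq : ContDiff ℝ ∞ (Λ.projSq e) := by
  refine ContDiff.sum fun i _ => ?_
  exact ((Λ.contDiff_re_form _).pow 2).add ((Λ.contDiff_im_form _).pow 2)

/-- The exhaustion function of the period space: the relative size of the projection to the span
of `e`. -/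
noncomputable def energy (v : Fin b → ℂ) : ℝ := Λ.projSq e v / Λ.hermSq v

theorem energy_smul {a : ℂ} (ha : a ≠ 0) (v : Fin b → ℂ) :
    Λ.energy e (a • v) = Λ.energy e v := by
  rw [energy, projSq_smul, hermSq_smul, energy,
    mul_div_mul_left _ _ (Complex.normSq_pos.2 ha).ne']

theorem contDiffAt_energy {v : Fin b → ℂ} (hv : 0 < Λ.hermSq v) :
    ContDiffAt ℝ ∞ (Λ.energy e) v :=
  (Λ.contDiff_projSq e).contDiffAt.div Λ.contDiff_hermSq.contDiffAt hv.ne'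

/-- The exhaustion function on the period space. -/
noncomputable def perEnergy (l : Λ.Per) : ℝ := Λ.energy e l.1.rep

theorem continuous_perEnergy : Continuous (Λ.perEnergy e) :=
  Λ.continuous_of_rep (fun _ hv => (Λ.contDiffAt_energy e hv).continuousAt)
    fun _ v ha => Λ.energy_smul e ha v

theorem perEnergy_toPer {v : Fin b → ℂ} (h0 : Λ.form ℂ v v = 0) (h1 : 0 < Λ.hermSq v) :
    Λ.perEnergy e (Λ.toPer v h0 h1) = Λ.energy e v := by
  obtain ⟨a, ha, h⟩ := Λ.exists_rep_toPer h0 h1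
  rw [perEnergy, h, energy_smul _ _ ha]

variable {Λ e}

/-- The projection enlarges the square of the real and of the imaginary part alike, so energy at
most `1` forces equality in both and puts both in the span. -/
theorem IsOrthonormal.setOf_perEnergy_le_one (he : Λ.IsOrthonormal e) :
    {l | Λ.perEnergy e l ≤ 1} = Λ.hkLine (Submodule.span ℝ (range e)) := by
  ext l
  have hpos : 0 < Λ.hermSq l.1.rep := l.2.2
  have h1 := he.form_self_le (reVec l.1.rep)
  have h2 := he.form_self_le (imVec l.1.rep)
  rw [mem_hkLine_iff, mem_cplx]
  change Λ.projSq e l.1.rep / Λ.hermSq l.1.rep ≤ 1 ↔ _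
  rw [div_le_one hpos, projSq_eq, hermSq_eq]
  constructor
  · intro h
    exact ⟨he.mem_span_of_form_self_ge (by linarith), he.mem_span_of_form_self_ge (by linarith)⟩
  · rintro ⟨h3, h4⟩
    rw [he.form_self_of_mem h3, he.form_self_of_mem h4]

/-- The positive definite form `2 ∑ q(eᵢ, x)² - q(x, x)` bounds the norm. -/
theorem IsOrthonormal.exists_norm_sq_le (he : Λ.IsOrthonormal e) :
    ∃ c > 0, ∀ x : Fin b → ℝ,
      c * ‖x‖ ^ 2 ≤ 2 * ∑ i, Λ.form ℝ (e i) x ^ 2 - Λ.form ℝ x x := by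
  let P : (Fin b → ℝ) → ℝ := fun x => 2 * ∑ i, Λ.form ℝ (e i) x ^ 2 - Λ.form ℝ x x
  have hP : Continuous P := by
    have h : ∀ i, Continuous fun x => Λ.form ℝ (e i) x := fun i =>
      LinearMap.continuous_of_finiteDimensional (Λ.form ℝ (e i))
    exact (continuous_const.mul (continuous_finsetSum _ fun i _ => (h i).pow 2)).sub
      Λ.continuous_realForm_self
  have hpos : ∀ x, x ≠ 0 → 0 < P x := by
    intro x hx
    have h1 := he.form_self_le x
    have h2 : 0 ≤ ∑ i, Λ.form ℝ (e i) x ^ 2 := Finset.sum_nonneg fun i _ => sq_nonneg _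
    change 0 < 2 * ∑ i, Λ.form ℝ (e i) x ^ 2 - Λ.form ℝ x x
    -- If the sum vanishes, `x` is orthogonal to the triple and `q` is negative there; otherwise one
    -- copy of the sum dominates `q(x, x)` and the other is positive.
    rcases h2.eq_or_lt with h3 | h3
    · have h4 : ∀ i, Λ.form ℝ (e i) x = 0 := fun i => by
        have := (Finset.sum_eq_zero_iff_of_nonneg fun i _ =>
          sq_nonneg (Λ.form ℝ (e i) x)).1 h3.symm i (Finset.mem_univ i)
        exact pow_eq_zero_iff two_ne_zero |>.1 this
      have := he.form_neg h4 hx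
      linarith
    · linarith
  have he0 : e 0 ≠ 0 := fun h => by
    have := he.2 0
    rw [h, map_zero] at this
    exact zero_ne_one this
  have hsm : ∀ (t : ℝ) x, P (t • x) = t ^ 2 * P x := by
    intro t x
    simp only [P, map_smul, LinearMap.smul_apply, smul_eq_mul, mul_pow, ← Finset.mul_sum]
    ring
  have hunit : ∀ x : Fin b → ℝ, x ≠ 0 → ‖x‖⁻¹ • x ∈ Metric.sphere (0 : Fin b → ℝ) 1 := by
    intro x hx
    rw [mem_sphere_zero_iff_norm, norm_smul, norm_inv, norm_norm,
      inv_mul_cancel₀ (norm_ne_zero_iff.2 hx)]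
  obtain ⟨z, hz, hmin⟩ := (isCompact_sphere (0 : Fin b → ℝ) 1).exists_isMinOn
    ⟨_, hunit _ he0⟩ hP.continuousOn
  refine ⟨P z, hpos z fun h => ?_, fun x => ?_⟩
  · rw [h, mem_sphere_zero_iff_norm, norm_zero] at hz
    exact zero_ne_one hz
  · change P z * ‖x‖ ^ 2 ≤ P x
    rcases eq_or_ne x 0 with rfl | hx
    · have : P 0 = 0 := by simpa using hsm 0 0
      rw [this, norm_zero]
      simp
    · have h1 : P z ≤ P (‖x‖⁻¹ • x) := hmin (hunit x hx)
      have hn : 0 < ‖x‖ := norm_pos_iff.2 hx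
      rw [hsm, inv_pow, inv_mul_eq_div, le_div_iff₀ (by positivity)] at h1
      exact h1

/-- With representatives normalized by `q(v, conj v) = 1`, the sublevel set is the image of a closed
set of vectors. That set is bounded because the definite form of `IsOrthonormal.exists_norm_sq_le`,
summed over real and imaginary parts, is at most `2 s - 1` on it. -/
theorem IsOrthonormal.isCompact_setOf_perEnergy_le (he : Λ.IsOrthonormal e) (s : ℝ) :
    IsCompact {l | Λ.perEnergy e l ≤ s} := by
  let K : Set (Fin b → ℂ) := {v | Λ.form ℂ v v = 0 ∧ Λ.hermSq v = 1 ∧ Λ.projSq e v ≤ s}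
  have hclosed : IsClosed K :=
    (isClosed_eq Λ.contDiff_form_self.continuous continuous_const).inter
      ((isClosed_eq Λ.contDiff_hermSq.continuous continuous_const).inter
        (isClosed_le (Λ.contDiff_projSq e).continuous continuous_const))
  have hbdd : Bornology.IsBounded K := by
    obtain ⟨c, hc, hle⟩ := he.exists_norm_sq_le
    rw [isBounded_iff_forall_norm_le]
    refine ⟨(2 * s / c + 1) + (2 * s / c + 1), fun v hv => ?_⟩
    obtain ⟨-, hv1, hv2⟩ := hv
    rw [hermSq_eq] at hv1
    rw [projSq_eq] at hv2
    have h1 := hle (reVec v)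
    have h2 := hle (imVec v)
    have h3 : 0 ≤ c * ‖reVec v‖ ^ 2 := by positivity
    have h4 : 0 ≤ c * ‖imVec v‖ ^ 2 := by positivity
    have hn : ∀ x : Fin b → ℝ, c * ‖x‖ ^ 2 ≤ 2 * s → ‖x‖ ≤ 2 * s / c + 1 := by
      intro x hx
      have : ‖x‖ ^ 2 ≤ 2 * s / c := by
        rw [le_div_iff₀ hc]
        linarith
      nlinarith [sq_nonneg (‖x‖ - 1)]
    have h5 := hn (reVec v) (by linarith)
    have h6 := hn (imVec v) (by linarith)
    have h7 : 0 ≤ 2 * s / c + 1 := (norm_nonneg _).trans h5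
    refine (pi_norm_le_iff_of_nonneg (by linarith)).2 fun i => ?_
    refine (Complex.norm_le_abs_re_add_abs_im (v i)).trans (add_le_add ?_ ?_)
    · exact (norm_le_pi_norm (reVec v) i).trans h5
    · exact (norm_le_pi_norm (imVec v) i).trans h6
  have hK : CompactSpace K :=
    isCompact_iff_compactSpace.1 (Metric.isCompact_of_isClosed_isBounded hclosed hbdd)
  have hpos : ∀ v : K, 0 < Λ.hermSq v.1 := fun v => v.2.2.1.symm ▸ one_pos
  have hcont : Continuous fun v : K => Λ.toPer v.1 v.2.1 (hpos v) :=
    Λ.continuous_toPer continuous_subtype_val _ _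
  convert isCompact_range hcont using 1
  ext l
  constructor
  · intro hl
    have hl : Λ.projSq e l.1.rep / Λ.hermSq l.1.rep ≤ s := hl
    have hp : 0 < Λ.hermSq l.1.rep := l.2.2
    have h0 : Λ.form ℂ l.1.rep l.1.rep = 0 := l.2.1
    let a : ℂ := ((√(Λ.hermSq l.1.rep))⁻¹ : ℝ)
    have ha : Complex.normSq a = (Λ.hermSq l.1.rep)⁻¹ := by
      rw [Complex.normSq_ofReal, ← mul_inv, Real.mul_self_sqrt hp.le]
    have h1 : Λ.hermSq (a • l.1.rep) = 1 := by rw [hermSq_smul, ha, inv_mul_cancel₀ hp.ne']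
    have h2 : Λ.form ℂ (a • l.1.rep) (a • l.1.rep) = 0 := by simp [h0]
    refine ⟨⟨a • l.1.rep, h2, h1, ?_⟩, ?_⟩
    · rwa [projSq_smul, ha, inv_mul_eq_div]
    · exact (Λ.toPer_smul h0 hp h2 (h1.symm ▸ one_pos)).trans (Λ.toPer_rep l)
  · rintro ⟨v, rfl⟩
    change Λ.perEnergy e _ ≤ s
    rw [perEnergy_toPer, energy, v.2.2.1, div_one]
    exact v.2.2.2

/-- The complex linear combination of a real triple. -/
noncomputable def comb (e : Fin 3 → Fin b → ℝ) (c : Fin 3 → ℂ) : Fin b → ℂ :=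
  ∑ i, c i • ofRealVec (e i)

theorem star_comb (e : Fin 3 → Fin b → ℝ) (c : Fin 3 → ℂ) : star (comb e c) = comb e (star c) := by
  simp [comb, star_sum, star_smul]

theorem IsOrthonormal.form_comb (he : Λ.IsOrthonormal e) (c d : Fin 3 → ℂ) :
    Λ.form ℂ (comb e c) (comb e d) = ∑ i, c i * d i := by
  simp only [comb, map_sum, map_smul, LinearMap.sum_apply, LinearMap.smul_apply, smul_eq_mul,
    form_ofRealVec]
  refine Finset.sum_congr rfl fun i _ => ?_
  rw [Finset.sum_eq_single i]
  · rw [he.2 i]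
    push_cast
    ring
  · intro j _ hj
    rw [he.1 j i hj]
    simp
  · simp

theorem IsOrthonormal.eq_comb (he : Λ.IsOrthonormal e) {v : Fin b → ℂ}
    (hv : v ∈ cplx (Submodule.span ℝ (range e))) :
    v = comb e fun i => Λ.form ℂ (ofRealVec (e i)) v := by
  ext k
  apply Complex.ext
  · have := congrFun (he.eq_proj hv.1) k
    simp only [proj, Finset.sum_apply, Pi.smul_apply, smul_eq_mul, reVec] at this
    simp only [comb, form_ofRealVec_left, Finset.sum_apply, Pi.smul_apply, smul_eq_mul,
      Complex.re_sum, ofRealVec, Complex.re_mul_ofReal]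
    exact this.symm
  · have := congrFun (he.eq_proj hv.2) k
    simp only [proj, Finset.sum_apply, Pi.smul_apply, smul_eq_mul, imVec] at this
    simp only [comb, form_ofRealVec_left, Finset.sum_apply, Pi.smul_apply, smul_eq_mul,
      Complex.im_sum, ofRealVec, Complex.im_mul_ofReal]
    exact this.symm

theorem comb_mem_cplx (e : Fin 3 → Fin b → ℝ) (c : Fin 3 → ℂ) :
    comb e c ∈ cplx (Submodule.span ℝ (range e)) :=
  Submodule.sum_mem _ fun i _ => Submodule.smul_mem _ _
    (ofRealVec_mem_cplx (Submodule.subset_span ⟨i, rfl⟩))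

/-- The standard parametrization of the conic `c₀² + c₁² + c₂² = 0`. -/
noncomputable def conic (p : ℂ × ℂ) : Fin 3 → ℂ :=
  ![p.1 ^ 2 - p.2 ^ 2, Complex.I * (p.1 ^ 2 + p.2 ^ 2), 2 * p.1 * p.2]

/-- The first two coordinates determine `s ^ 2` and `t ^ 2`. The equation of the conic then gives `2
s t` up to sign, and replacing `t` by `-t` corrects the sign. -/
theorem exists_conic_eq {c : Fin 3 → ℂ} (hc : ∑ i, c i * c i = 0) : ∃ p, conic p = c := by
  rw [Fin.sum_univ_three] at hc
  obtain ⟨s, hs⟩ := IsAlgClosed.exists_pow_nat_eq ((c 0 - Complex.I * c 1) / 2) two_pos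
  obtain ⟨t, ht⟩ := IsAlgClosed.exists_pow_nat_eq (-(c 0 + Complex.I * c 1) / 2) two_pos
  have hI := Complex.I_sq
  have h : (2 * s * t) ^ 2 = c 2 ^ 2 := by
    rw [mul_pow, mul_pow, hs, ht]
    linear_combination c 1 ^ 2 * hI - hc
  have h0 : s ^ 2 - t ^ 2 = c 0 := by rw [hs, ht]; ring
  have h1 : Complex.I * (s ^ 2 + t ^ 2) = c 1 := by
    rw [hs, ht]
    linear_combination -c 1 * hI
  rcases sq_eq_sq_iff_eq_or_eq_neg.1 h with h2 | h2
  · refine ⟨(s, t), ?_⟩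
    ext i
    fin_cases i
    · exact h0
    · exact h1
    · exact h2
  · refine ⟨(s, -t), ?_⟩
    ext i
    fin_cases i
    · change s ^ 2 - (-t) ^ 2 = c 0
      rw [neg_sq, h0]
    · change Complex.I * (s ^ 2 + (-t) ^ 2) = c 1
      rw [neg_sq, h1]
    · change 2 * s * -t = c 2
      linear_combination -h2

/-- In an orthonormal basis the line is a smooth conic, the image of the connected set `ℂ² \ {0}`
under its quadratic parametrization. -/
theorem IsOrthonormal.isPreconnected_hkLine (he : Λ.IsOrthonormal e) :
    IsPreconnected (Λ.hkLine (Submodule.span ℝ (range e))) := by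
  have hconn : IsPreconnected ({0}ᶜ : Set (ℂ × ℂ)) := by
    refine (isConnected_compl_singleton_of_one_lt_rank ?_ 0).isPreconnected
    rw [← Module.finrank_eq_rank]
    norm_num [Module.finrank_prod, Complex.finrank_real_complex]
  have : PreconnectedSpace ({0}ᶜ : Set (ℂ × ℂ)) := isPreconnected_iff_preconnectedSpace.1 hconn
  let f : ({0}ᶜ : Set (ℂ × ℂ)) → Fin b → ℂ := fun p => comb e (conic p.1)
  have hf : Continuous f := by
    simp only [f, comb, conic, Fin.sum_univ_three]
    fun_prop
  have h0 : ∀ p, Λ.form ℂ (f p) (f p) = 0 := by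
    intro p
    have hI := Complex.I_sq
    simp only [f, he.form_comb, Fin.sum_univ_three, conic, Matrix.cons_val]
    linear_combination (p.1.1 ^ 2 + p.1.2 ^ 2) ^ 2 * hI
  have h1 : ∀ p, 0 < Λ.hermSq (f p) := by
    rintro ⟨⟨s, t⟩, hp⟩
    have h2 : Λ.hermSq (f ⟨⟨s, t⟩, hp⟩) = 2 * (Complex.normSq s + Complex.normSq t) ^ 2 := by
      simp only [f, hermSq, star_comb, he.form_comb, Fin.sum_univ_three, conic]
      simp [Complex.normSq_apply, pow_two]
      ring
    have h3 : 0 < Complex.normSq s + Complex.normSq t := by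
      have hs := Complex.normSq_nonneg s
      have ht := Complex.normSq_nonneg t
      refine (add_nonneg hs ht).lt_of_ne fun h => hp ?_
      have h4 : s = 0 := Complex.normSq_eq_zero.1 (by linarith)
      have h5 : t = 0 := Complex.normSq_eq_zero.1 (by linarith)
      rw [h4, h5]
      rfl
    rw [h2]
    positivity
  have hrange : Λ.hkLine (Submodule.span ℝ (range e)) =
      range fun p => Λ.toPer (f p) (h0 p) (h1 p) := by
    ext l
    constructor
    · intro hl
      have h2 := he.eq_comb (Λ.mem_hkLine_iff.1 hl)
      have h3 : Λ.form ℂ l.1.rep l.1.rep = 0 := l.2.1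
      rw [h2, he.form_comb] at h3
      obtain ⟨p, hp⟩ := exists_conic_eq h3
      have hfp : comb e (conic p) = l.1.rep := by rw [hp, ← h2]
      have hp0 : p ≠ 0 := by
        rintro rfl
        refine l.1.rep_nonzero ?_
        rw [← hfp]
        simp [comb, conic, Fin.sum_univ_three]
      refine ⟨⟨p, hp0⟩, ?_⟩
      refine Eq.trans ?_ (Λ.toPer_rep l)
      simp only [f, hfp]
    · rintro ⟨p, rfl⟩
      exact (Λ.toPer_mem_hkLine_iff _ _).2 (comb_mem_cplx e _)
  rw [hrange]
  exact isPreconnected_range (Λ.continuous_toPer hf h0 h1)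

end Energy

end BBFLattice

/-! ### Uniform decrease near a point. -/

section StrictDerivative

open Filter Topology

/-- A strictly differentiable function decreases uniformly near a point, in any direction in which
its derivative there is negative. -/
theorem HasStrictFDerivAt.exists_lt_of_neg {V : Type*} [NormedAddCommGroup V] [NormedSpace ℝ V]
    {G : V → ℝ} {G' : V →L[ℝ] ℝ} {u₀ ζ : V} (hG : HasStrictFDerivAt G G' u₀) (hζ : G' ζ < 0) :
    ∀ᶠ p : V × ℝ in 𝓝 (u₀, 0), 0 < p.2 → G (p.1 + p.2 • ζ) < G p.1 := by
  have hζ0 : 0 < ‖ζ‖ := norm_pos_iff.2 fun h => by simp [h] at hζ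
  -- With this constant the error term is at most half of the linear decrease.
  have hc : 0 < -G' ζ / (2 * ‖ζ‖) := div_pos (neg_pos.2 hζ) (by positivity)
  have h1 := hG.isLittleO.def hc
  have h2 : Tendsto (fun p : V × ℝ => (p.1 + p.2 • ζ, p.1)) (𝓝 (u₀, 0)) (𝓝 (u₀, u₀)) := by
    have : Continuous fun p : V × ℝ => (p.1 + p.2 • ζ, p.1) := by fun_prop
    simpa using this.tendsto (u₀, 0)
  filter_upwards [h2.eventually h1] with p hp hpos
  simp only [add_sub_cancel_left, map_smul, smul_eq_mul, norm_smul, Real.norm_eq_abs,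
    _root_.abs_of_pos hpos] at hp
  have h3 : -G' ζ / (2 * ‖ζ‖) * (p.2 * ‖ζ‖) = p.2 * (-G' ζ) / 2 := by
    field_simp
  rw [h3] at hp
  have h4 := (abs_le.1 hp).2
  have h5 : 0 < p.2 * (-G' ζ) := mul_pos hpos (neg_pos.2 hζ)
  linarith

end StrictDerivative

namespace BBFLattice

/-! ### Curves in hyperkähler lines, and the derivative of the energy along them. -/

section Curves

open Set Filter Topology

variable {b : ℕ} (Λ : BBFLattice b) (l : Λ.Per)

theorem base_re_pos : 0 < Λ.form ℝ (reVec (Λ.base l)) (reVec (Λ.base l)) := by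
  have h1 : 0 < Λ.hermSq (Λ.base l) := l.2.2
  have h2 := (Λ.form_self_eq_zero_iff _).1 (Λ.base_base l)
  rw [hermSq_eq, h2.1] at h1
  linarith

theorem base_im_im : Λ.form ℝ (imVec (Λ.base l)) (imVec (Λ.base l)) =
    Λ.form ℝ (reVec (Λ.base l)) (reVec (Λ.base l)) :=
  ((Λ.form_self_eq_zero_iff _).1 (Λ.base_base l)).1

theorem base_re_im : Λ.form ℝ (reVec (Λ.base l)) (imVec (Λ.base l)) = 0 :=
  ((Λ.form_self_eq_zero_iff _).1 (Λ.base_base l)).2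

/-- The orthogonal complement of the plane of `l`. -/
noncomputable def planePerp : Submodule ℝ (Fin b → ℝ) :=
  Λ.perp (reVec (Λ.base l)) (imVec (Λ.base l))

variable {l} {w : Fin b → ℝ}

theorem form_base_ofRealVec (hw : w ∈ Λ.planePerp l) :
    Λ.form ℂ (Λ.base l) (ofRealVec w) = 0 := by
  have := Λ.mem_perp.1 hw
  apply Complex.ext <;> simp [form_re, form_im, this.1, this.2]

theorem form_starBase_ofRealVec (hw : w ∈ Λ.planePerp l) :
    Λ.form ℂ (star (Λ.base l)) (ofRealVec w) = 0 := by
  rw [← star_ofRealVec, form_star, Λ.form_base_ofRealVec hw, star_zero]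

/-- The direction in the chart at `l` which corresponds to `a • w`. -/
noncomputable def dir (l : Λ.Per) (w : Fin b → ℝ) (a : ℂ) : Fin (b - 2) → ℂ :=
  Λ.coord l (a • ofRealVec w)

theorem incl_dir (hw : w ∈ Λ.planePerp l) (a : ℂ) (t : ℝ) :
    Λ.incl l (t • Λ.dir l w a) = ((t : ℂ) * a) • ofRealVec w := by
  have h : Λ.incl l (Λ.dir l w a) = a • ofRealVec w := by
    rw [dir, incl_coord, map_smul, map_smul, Λ.form_base_ofRealVec hw,
      Λ.form_starBase_ofRealVec hw]
    simp
  rw [LinearMap.map_smul_of_tower, h, mul_smul]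
  rfl

theorem lift_dir (hw : w ∈ Λ.planePerp l) (a : ℂ) (t : ℝ) :
    Λ.lift l (t • Λ.dir l w a) = Λ.base l + ((t : ℂ) * a) • ofRealVec w
      - (((t : ℂ) * a) ^ 2 * (Λ.form ℝ w w : ℂ) / (2 * Λ.baseNorm l)) • star (Λ.base l) := by
  rw [lift, Λ.incl_dir hw]
  congr 2
  rw [map_smul, map_smul, LinearMap.smul_apply, form_ofRealVec]
  simp only [smul_eq_mul]
  ring

theorem lift_dir_mem_cplx (hw : w ∈ Λ.planePerp l) {W : Submodule ℝ (Fin b → ℝ)}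
    (hwW : w ∈ W) (hl : l ∈ Λ.hkLine W) (a : ℂ) (t : ℝ) :
    Λ.lift l (t • Λ.dir l w a) ∈ cplx W := by
  have hb : Λ.base l ∈ cplx W := Λ.mem_hkLine_iff.1 hl
  rw [Λ.lift_dir hw]
  exact Submodule.sub_mem _ (Submodule.add_mem _ hb (Submodule.smul_mem _ _
    (ofRealVec_mem_cplx hwW))) (Submodule.smul_mem _ _ (star_mem_cplx hb))

theorem chart_symm_mem_hkLine (hw : w ∈ Λ.planePerp l) {W : Submodule ℝ (Fin b → ℝ)}
    (hwW : w ∈ W) (hl : l ∈ Λ.hkLine W) {a : ℂ} {t : ℝ}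
    (ht : t • Λ.dir l w a ∈ (Λ.chart l).target) :
    (Λ.chart l).symm (t • Λ.dir l w a) ∈ Λ.hkLine W := by
  obtain ⟨c, -, h⟩ := Λ.exists_chart_symm_rep ht
  rw [mem_hkLine_iff, h]
  exact Submodule.smul_mem _ _ (Λ.lift_dir_mem_cplx hw hwW hl a t)

/-- There is no linear term, since `w` is orthogonal to `v₀` and `conj v₀`. So the denominator of
the energy does not contribute to the derivative at `0`. -/
theorem hermSq_lift_dir (hw : w ∈ Λ.planePerp l) (a : ℂ) : ∃ k₁ k₂ : ℝ, ∀ t : ℝ,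
    Λ.hermSq (Λ.lift l (t • Λ.dir l w a)) = Λ.hermSq (Λ.base l) + t ^ 2 * k₁ + t ^ 4 * k₂ := by
  set κ : ℂ := a ^ 2 * (Λ.form ℝ w w : ℂ) / (2 * Λ.baseNorm l)
  refine ⟨Complex.normSq a * Λ.form ℝ w w, Complex.normSq κ * Λ.hermSq (Λ.base l), fun t => ?_⟩
  have h1 : Λ.form ℂ (Λ.base l) (ofRealVec w) = 0 := Λ.form_base_ofRealVec hw
  have h2 : Λ.form ℂ (star (Λ.base l)) (ofRealVec w) = 0 := Λ.form_starBase_ofRealVec hw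
  have h3 : Λ.form ℂ (ofRealVec w) (Λ.base l) = 0 := (Λ.form_symm _ _).trans h1
  have h4 : Λ.form ℂ (ofRealVec w) (star (Λ.base l)) = 0 := (Λ.form_symm _ _).trans h2
  have h5 : Λ.form ℂ (Λ.base l) (star (Λ.base l)) = (Λ.hermSq (Λ.base l) : ℂ) :=
    Λ.form_star_self _
  have h6 : Λ.form ℂ (star (Λ.base l)) (Λ.base l) = (Λ.hermSq (Λ.base l) : ℂ) :=
    (Λ.form_symm _ _).trans h5
  have hκ : ((t : ℂ) * a) ^ 2 * (Λ.form ℝ w w : ℂ) / (2 * Λ.baseNorm l) = (t : ℂ) ^ 2 * κ := by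
    simp only [κ]
    ring
  have ha := Complex.mul_conj a
  have hκ' := Complex.mul_conj κ
  apply Complex.ofReal_injective
  rw [← form_star_self, Λ.lift_dir hw, hκ]
  simp only [star_add, star_sub, star_smul, star_ofRealVec, star_star, map_add, map_sub, map_smul,
    LinearMap.add_apply, LinearMap.sub_apply, LinearMap.smul_apply, smul_eq_mul, h1, h2, h3, h4,
    h5, h6, form_ofRealVec, base_base, starBase_starBase, star_mul', Complex.star_def,
    Complex.conj_ofReal, map_pow, Complex.ofReal_add, Complex.ofReal_mul, Complex.ofReal_pow,
    ← ha, ← hκ']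
  ring

theorem form_lift_dir (hw : w ∈ Λ.planePerp l) (a : ℂ) (x : Fin b → ℂ) : ∃ k : ℂ, ∀ t : ℝ,
    Λ.form ℂ x (Λ.lift l (t • Λ.dir l w a)) =
      Λ.form ℂ x (Λ.base l) + (t : ℂ) * (a * Λ.form ℂ x (ofRealVec w)) - (t : ℂ) ^ 2 * k := by
  refine ⟨a ^ 2 * (Λ.form ℝ w w : ℂ) / (2 * Λ.baseNorm l) * Λ.form ℂ x (star (Λ.base l)),
    fun t => ?_⟩
  rw [Λ.lift_dir hw]
  simp only [map_add, map_sub, map_smul, smul_eq_mul]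
  ring

/-- Only the numerator contributes. Its derivative is twice the real part of `a` times the conjugate
of `q(pr v₀, w)`, where `pr` is the projection to the span of `e`; so a suitable `a` makes it
negative whenever this pairing is nonzero. -/
theorem hasDerivAt_energy_lift_dir (e : Fin 3 → Fin b → ℝ) (hw : w ∈ Λ.planePerp l) (a : ℂ) :
    HasDerivAt (fun t : ℝ => Λ.energy e (Λ.lift l (t • Λ.dir l w a)))
      (2 * (a * ((Λ.form ℝ (Λ.proj e (reVec (Λ.base l))) w : ℂ) -
        (Λ.form ℝ (Λ.proj e (imVec (Λ.base l))) w : ℂ) * Complex.I)).re / Λ.hermSq (Λ.base l)) 0 := by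
  obtain ⟨k₁, k₂, hk⟩ := Λ.hermSq_lift_dir hw a
  have hpos : 0 < Λ.hermSq (Λ.base l) := l.2.2
  have hden : HasDerivAt (fun t : ℝ => Λ.hermSq (Λ.lift l (t • Λ.dir l w a))) 0 0 := by
    simp only [hk]
    have h := ((((hasDerivAt_id' (0 : ℝ)).fun_pow 2).mul_const k₁).const_add
      (Λ.hermSq (Λ.base l))).fun_add (((hasDerivAt_id' (0 : ℝ)).fun_pow 4).mul_const k₂)
    exact h.congr_deriv (by simp)
  have hquad : ∀ p q r : ℝ, HasDerivAt (fun t : ℝ => (p + t * q - t ^ 2 * r) ^ 2) (2 * (p * q)) 0 := by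
    intro p q r
    have h := ((((hasDerivAt_id' (0 : ℝ)).mul_const q).const_add p).fun_sub
      (((hasDerivAt_id' (0 : ℝ)).fun_pow 2).mul_const r)).fun_pow 2
    exact h.congr_deriv (by simp; ring)
  have hnum : HasDerivAt (fun t : ℝ => Λ.projSq e (Λ.lift l (t • Λ.dir l w a)))
      (2 * (a * ((Λ.form ℝ (Λ.proj e (reVec (Λ.base l))) w : ℂ) -
        (Λ.form ℝ (Λ.proj e (imVec (Λ.base l))) w : ℂ) * Complex.I)).re) 0 := by
    have hterm : ∀ i, HasDerivAt (fun t : ℝ =>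
        (Λ.form ℂ (ofRealVec (e i)) (Λ.lift l (t • Λ.dir l w a))).re ^ 2 +
          (Λ.form ℂ (ofRealVec (e i)) (Λ.lift l (t • Λ.dir l w a))).im ^ 2)
        (2 * (Λ.form ℝ (e i) w * (Λ.form ℝ (e i) (reVec (Λ.base l)) * a.re +
          Λ.form ℝ (e i) (imVec (Λ.base l)) * a.im))) 0 := by
      intro i
      obtain ⟨k, hk⟩ := Λ.form_lift_dir hw a (ofRealVec (e i))
      have hre : ∀ t : ℝ, (Λ.form ℂ (ofRealVec (e i)) (Λ.lift l (t • Λ.dir l w a))).re =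
          Λ.form ℝ (e i) (reVec (Λ.base l)) + t * (a.re * Λ.form ℝ (e i) w) - t ^ 2 * k.re := by
        intro t
        rw [hk, form_ofRealVec, form_ofRealVec_left]
        simp [← Complex.ofReal_pow]
      have him : ∀ t : ℝ, (Λ.form ℂ (ofRealVec (e i)) (Λ.lift l (t • Λ.dir l w a))).im =
          Λ.form ℝ (e i) (imVec (Λ.base l)) + t * (a.im * Λ.form ℝ (e i) w) - t ^ 2 * k.im := by
        intro t
        rw [hk, form_ofRealVec, form_ofRealVec_left]
        simp [← Complex.ofReal_pow]
      simp only [hre, him]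
      exact ((hquad _ _ _).fun_add (hquad _ _ _)).congr_deriv (by ring)
    have h := HasDerivAt.fun_sum (u := Finset.univ) fun i _ => hterm i
    refine h.congr_deriv ?_
    simp only [proj, map_sum, LinearMap.sum_apply, map_smul, LinearMap.smul_apply, smul_eq_mul]
    simp only [Complex.mul_re, Complex.sub_re, Complex.sub_im, Complex.ofReal_re,
      Complex.ofReal_im, Complex.mul_im, Complex.I_re, Complex.I_im, Fin.sum_univ_three]
    ring
  have h0 : Λ.lift l ((0 : ℝ) • Λ.dir l w a) = Λ.base l := by
    rw [Λ.lift_dir hw]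
    simp
  refine (hnum.fun_div hden (by rw [h0]; exact hpos.ne')).congr_deriv ?_
  rw [h0]
  field_simp
  ring

end Curves

end BBFLattice

namespace BBFLattice

/-! ### Descent along generic hyperkähler lines, and connectedness of the period space. -/

section Descent

open Set Filter Topology

variable {b : ℕ} {Λ : BBFLattice b} {e : Fin 3 → Fin b → ℝ}

theorem perEnergy_chart_symm {l : Λ.Per} {u : Fin (b - 2) → ℂ} (hu : u ∈ (Λ.chart l).target) :
    Λ.perEnergy e ((Λ.chart l).symm u) = Λ.energy e (Λ.lift l u) := by
  obtain ⟨a, ha, h⟩ := Λ.exists_chart_symm_rep hu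
  rw [perEnergy, h, energy_smul _ _ ha]

theorem zero_mem_chart_target (l : Λ.Per) : (0 : Fin (b - 2) → ℂ) ∈ (Λ.chart l).target := by
  rw [← Λ.chart_self l]
  exact (Λ.chart l).map_source (Λ.self_mem_chart_source l)

theorem chart_symm_zero (l : Λ.Per) : (Λ.chart l).symm 0 = l := by
  rw [← Λ.chart_self l]
  exact (Λ.chart l).left_inv (Λ.self_mem_chart_source l)

theorem mem_hkLine_span {l : Λ.Per} {w : Fin b → ℝ} : l ∈ Λ.hkLine (Submodule.span ℝ
    (range (![reVec (Λ.base l), imVec (Λ.base l), w] : Fin 3 → Fin b → ℝ))) :=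
  Λ.mem_hkLine_iff.2 ⟨Submodule.subset_span ⟨0, rfl⟩, Submodule.subset_span ⟨1, rfl⟩⟩

theorem mem_span_triple {x y w : Fin b → ℝ} :
    w ∈ Submodule.span ℝ (range (![x, y, w] : Fin 3 → Fin b → ℝ)) :=
  Submodule.subset_span ⟨2, rfl⟩

/-- The difference `z - Λ.proj e z` lies in the positive plane, but also in the orthogonal
complement of the triple, where `q` is negative definite. -/
theorem IsOrthonormal.eq_proj_of_mem_plane (he : Λ.IsOrthonormal e) (l : Λ.Per)
    {z : Fin b → ℝ} (hz : z ∈ Submodule.span ℝ {reVec (Λ.base l), imVec (Λ.base l)})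
    (hz' : Λ.proj e z ∈ Submodule.span ℝ {reVec (Λ.base l), imVec (Λ.base l)}) :
    Λ.proj e z = z := by
  by_contra hne
  have h1 := Submodule.sub_mem _ hz hz'
  obtain ⟨c, d, hcd⟩ := Submodule.mem_span_pair.1 h1
  have h2 : Λ.form ℝ (z - Λ.proj e z) (z - Λ.proj e z) < 0 :=
    he.form_neg (he.form_sub_proj z) (sub_ne_zero.2 (Ne.symm hne))
  rw [← hcd] at h2
  simp only [map_add, map_smul, LinearMap.add_apply, LinearMap.smul_apply, smul_eq_mul,
    Λ.realForm_symm (imVec (Λ.base l)) (reVec (Λ.base l)), Λ.base_re_im, Λ.base_im_im] at h2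
  have h3 := Λ.base_re_pos l
  nlinarith [mul_nonneg (sq_nonneg c) h3.le, mul_nonneg (sq_nonneg d) h3.le]

/-- Where the energy is not minimal, some direction orthogonal to the plane of `l` pairs
nontrivially with the projection of the plane. -/
theorem IsOrthonormal.exists_not_mem_ker (he : Λ.IsOrthonormal e) {l : Λ.Per}
    (hl : 1 < Λ.perEnergy e l) : ∃ z, (z = reVec (Λ.base l) ∨ z = imVec (Λ.base l)) ∧
      ∃ w ∈ Λ.planePerp l, w ∉ LinearMap.ker (Λ.form ℝ (Λ.proj e z)) := by
  by_contra! h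
  -- If both projections are orthogonal to the complement of the plane, they lie in the plane and
  -- hence equal the original vectors. Then the plane lies in the span of `e`, where the energy is
  -- `1`.
  have hproj : ∀ z, (z = reVec (Λ.base l) ∨ z = imVec (Λ.base l)) → Λ.proj e z = z := by
    intro z hz
    refine he.eq_proj_of_mem_plane l (Submodule.subset_span (by simpa using hz)) ?_
    refine Λ.mem_span_pair_of_forall_perp (Λ.base_re_pos l) (Λ.base_im_im l) (Λ.base_re_im l)
      fun w hw => ?_
    rw [realForm_symm]
    exact h z hz w hw
  have hmem : l ∈ Λ.hkLine (Submodule.span ℝ (range e)) := by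
    rw [mem_hkLine_iff]
    refine ⟨?_, ?_⟩
    · rw [← show Λ.proj e (reVec l.1.rep) = reVec l.1.rep from hproj _ (Or.inl rfl)]
      exact Λ.proj_mem e _
    · rw [← show Λ.proj e (imVec l.1.rep) = imVec l.1.rep from hproj _ (Or.inr rfl)]
      exact Λ.proj_mem e _
  rw [← he.setOf_perEnergy_le_one] at hmem
  exact absurd hl (not_lt.2 hmem)

/-- At each point outside of `S_W`, the energy decreases along a curve in a generic hyperkähler
line, and along the nearby curves which are parallel to it in the chart. -/
theorem IsOrthonormal.exists_localDescent (he : Λ.IsOrthonormal e) {p : Λ.Per}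
    (hp : 1 < Λ.perEnergy e p) : ∃ W, Λ.IsGHK W ∧ ∃ d : LocalDescent (Λ.perEnergy e) p,
      ∀ t ∈ Icc 0 d.len, d.flow t p ∈ Λ.hkLine W := by
  obtain ⟨z, hz, hw⟩ := he.exists_not_mem_ker hp
  -- A generic third direction `w` can be chosen off the kernel, so that the line is GHK and the
  -- energy is not stationary along it.
  obtain ⟨w, hw, -, hwz, hW⟩ := Λ.exists_isGHK (Λ.base_re_pos p) (Λ.base_im_im p)
    (Λ.base_re_im p) hw
  refine ⟨_, hW, ?_⟩
  set r := Λ.form ℝ (Λ.proj e (reVec (Λ.base p))) w with hr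
  set i := Λ.form ℝ (Λ.proj e (imVec (Λ.base p))) w with hi
  have hri : 0 < r ^ 2 + i ^ 2 := by
    rcases hz with rfl | rfl
    · have : r ≠ 0 := hwz
      positivity
    · have : i ≠ 0 := hwz
      positivity
  -- With this factor the derivative of the energy is `-2 (r ^ 2 + i ^ 2)` divided by the hermitian
  -- square of the base vector.
  set ζ := Λ.dir p w ⟨-r, -i⟩ with hζ
  have hpos : 0 < Λ.hermSq (Λ.base p) := p.2.2
  have hlift0 : Λ.lift p 0 = Λ.base p := by
    have := Λ.lift_dir hw 0 0
    simpa using this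
  have hG : ContDiffAt ℝ ∞ (fun u => Λ.energy e (Λ.lift p u)) 0 :=
    ContDiffAt.comp _ (Λ.contDiffAt_energy e (by rw [hlift0]; exact hpos))
      (Λ.contDiff_lift p).contDiffAt
  have hstrict := hG.hasStrictFDerivAt (by simp)
  set G' := fderiv ℝ (fun u => Λ.energy e (Λ.lift p u)) 0
  have hneg : G' ζ < 0 := by
    have h1 : HasDerivAt (fun t : ℝ => t • ζ) ζ 0 := by
      simpa using (hasDerivAt_id' (0 : ℝ)).smul_const ζ
    have h2 : HasFDerivAt (fun u => Λ.energy e (Λ.lift p u)) G' ((0 : ℝ) • ζ) := by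
      rw [zero_smul]
      exact hstrict.hasFDerivAt
    have h3 := (h2.comp_hasDerivAt (0 : ℝ) h1).unique
      (Λ.hasDerivAt_energy_lift_dir e hw ⟨-r, -i⟩)
    rw [h3, ← hr, ← hi]
    refine div_neg_of_neg_of_pos ?_ hpos
    simp only [Complex.mul_re, Complex.sub_re, Complex.sub_im, Complex.ofReal_re,
      Complex.ofReal_im, Complex.mul_im, Complex.I_re, Complex.I_im]
    nlinarith
  have htar : ∀ᶠ q : (Fin (b - 2) → ℂ) × ℝ in 𝓝 (0, 0), q.1 + q.2 • ζ ∈ (Λ.chart p).target := by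
    have hc : Continuous fun q : (Fin (b - 2) → ℂ) × ℝ => q.1 + q.2 • ζ := by fun_prop
    refine hc.continuousAt.eventually_mem ((Λ.chart p).open_target.mem_nhds ?_)
    simpa using zero_mem_chart_target p
  obtain ⟨ε, hε, hball⟩ := Metric.eventually_nhds_iff_ball.1
    (htar.and (hstrict.exists_lt_of_neg hneg))
  have hin : ∀ u ∈ Metric.ball (0 : Fin (b - 2) → ℂ) ε, ∀ t ∈ Icc 0 (ε / 2),
      (u, t) ∈ Metric.ball ((0 : Fin (b - 2) → ℂ), (0 : ℝ)) ε := by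
    intro u hu t ht
    rw [← ball_prod_same]
    refine ⟨hu, ?_⟩
    rw [Metric.mem_ball, Real.dist_eq, sub_zero, _root_.abs_of_nonneg ht.1]
    linarith [ht.2]
  set N := (Λ.chart p).source ∩ Λ.chart p ⁻¹' Metric.ball 0 ε
  have hN : N ∈ 𝓝 p := by
    refine inter_mem ((Λ.chart p).open_source.mem_nhds (Λ.self_mem_chart_source p)) ?_
    refine ((Λ.chart p).continuousAt (Λ.self_mem_chart_source p)).preimage_mem_nhds ?_
    rw [Λ.chart_self]
    exact Metric.ball_mem_nhds _ hε
  -- The flow is translation by `t • ζ` in the chart. Decrease is needed from all nearby points, but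
  -- only the trajectory of `p` has to stay in the GHK line.
  let d : LocalDescent (Λ.perEnergy e) p :=
    { flow := fun t q => (Λ.chart p).symm (Λ.chart p q + t • ζ)
      len := ε / 2
      nhd := N
      len_pos := half_pos hε
      nhd_mem := hN
      continuousOn_flow := by
        have h1 : ContinuousOn (fun x : ℝ × Λ.Per => Λ.chart p x.2 + x.1 • ζ)
            (Icc 0 (ε / 2) ×ˢ N) := by
          refine ContinuousOn.add ?_ (by fun_prop)
          exact (Λ.chart p).continuousOn.comp continuous_snd.continuousOn fun x hx => hx.2.1
        exact (Λ.chart p).continuousOn_symm.comp h1 fun x hx =>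
          (hball _ (hin _ hx.2.2 _ hx.1)).1
      flow_zero := fun q hq => by
        rw [zero_smul, add_zero]
        exact (Λ.chart p).left_inv hq.1
      lt_of_pos := fun q hq t ht htl => by
        obtain ⟨h1, h2⟩ := hball _ (hin _ hq.2 t ⟨ht.le, htl⟩)
        have h3 : Λ.perEnergy e q = Λ.energy e (Λ.lift p (Λ.chart p q)) := by
          rw [← perEnergy_chart_symm ((Λ.chart p).map_source hq.1), (Λ.chart p).left_inv hq.1]
        rw [perEnergy_chart_symm h1, h3]
        exact h2 ht }
  refine ⟨d, fun t ht => ?_⟩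
  have h1 := (hball _ (hin 0 (Metric.mem_ball_self hε) t ht)).1
  change (Λ.chart p).symm (Λ.chart p p + t • ζ) ∈ _
  rw [Λ.chart_self, zero_add]
  rw [zero_add] at h1
  exact Λ.chart_symm_mem_hkLine hw mem_span_triple mem_hkLine_span h1

/-- Each period lies on a generic hyperkähler line. -/
theorem exists_isOrthonormal_isGHK (l : Λ.Per) : ∃ e, Λ.IsOrthonormal e ∧
    Λ.IsGHK (Submodule.span ℝ (range e)) ∧ l ∈ Λ.hkLine (Submodule.span ℝ (range e)) := by
  obtain ⟨W, hW⟩ := Λ.exists_isPositiveThreeSpace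
  obtain ⟨w₀, -, hw₀, hw₀p⟩ := Λ.exists_mem_inf_perp hW (reVec (Λ.base l)) (imVec (Λ.base l))
  obtain ⟨w, hw, hwp, -, hGHK⟩ := Λ.exists_isGHK (Λ.base_re_pos l) (Λ.base_im_im l)
    (Λ.base_re_im l) (Z := ⊥) ⟨w₀, hw₀, fun h => by
      rw [(Submodule.mem_bot ℝ).1 h, map_zero] at hw₀p
      exact lt_irrefl _ hw₀p⟩
  set f : Fin 3 → Fin b → ℝ := ![reVec (Λ.base l), imVec (Λ.base l), w]
  have hf : ∀ i j, i ≠ j → Λ.form ℝ (f i) (f j) = 0 := Λ.orthogonal_triple (Λ.base_re_im l) hw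
  have hpos : ∀ i, 0 < Λ.form ℝ (f i) (f i) := by
    intro i
    fin_cases i
    · exact Λ.base_re_pos l
    · exact (Λ.base_im_im l).symm ▸ Λ.base_re_pos l
    · exact hwp
  let e : Fin 3 → Fin b → ℝ := fun i => (√(Λ.form ℝ (f i) (f i)))⁻¹ • f i
  have he : Λ.IsOrthonormal e := by
    refine ⟨fun i j hij => by simp [e, hf i j hij], fun i => ?_⟩
    have h1 := Real.mul_self_sqrt (hpos i).le
    have h2 := (Real.sqrt_pos.2 (hpos i)).ne'
    simp only [e, map_smul, LinearMap.smul_apply, smul_eq_mul]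
    field_simp
    rw [sq, h1]
  have hspan : Submodule.span ℝ (range e) = Submodule.span ℝ (range f) := by
    refine Submodule.eq_of_le_of_finrank_eq (Submodule.span_le.2 ?_)
      (he.isPositiveThreeSpace.1.trans hGHK.1.1.symm)
    rintro _ ⟨i, rfl⟩
    exact Submodule.smul_mem _ _ (Submodule.subset_span ⟨i, rfl⟩)
  refine ⟨e, he, ?_, ?_⟩
  · rw [hspan]
    exact hGHK
  · rw [hspan]
    exact mem_hkLine_span

variable (Λ) in
-- Descent connects every point to the conic of minimal energy, which is connected.
theorem preconnectedSpace_per : PreconnectedSpace Λ.Per := by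
  rcases isEmpty_or_nonempty Λ.Per with h | ⟨⟨l⟩⟩
  · infer_instance
  · obtain ⟨e, he, -, -⟩ := exists_isOrthonormal_isGHK l
    refine preconnectedSpace_of_localDescent (a := 1) (Λ.continuous_perEnergy e)
      he.isCompact_setOf_perEnergy_le (fun p hp => ?_) ?_
    · obtain ⟨W, -, d, -⟩ := he.exists_localDescent hp
      exact ⟨d⟩
    · rw [he.setOf_perEnergy_le_one]
      exact he.isPreconnected_hkLine

end Descent

section GHKLines

/-! ### Sections over GHK lines, and their extension to the period space. -/

open Set Filter Topology

variable {b : ℕ} {Λ : BBFLattice b} {W : Submodule ℝ (Fin b → ℝ)}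

theorem eq_span_triple {l : Λ.Per} (hW : Λ.IsPositiveThreeSpace W) (hl : l ∈ Λ.hkLine W)
    {w : Fin b → ℝ} (hw : w ∈ Λ.planePerp l) (hwW : w ∈ W) (hwp : 0 < Λ.form ℝ w w) :
    Submodule.span ℝ (range (![reVec (Λ.base l), imVec (Λ.base l), w] : Fin 3 → Fin b → ℝ)) =
      W := by
  have hb : Λ.base l ∈ cplx W := Λ.mem_hkLine_iff.1 hl
  refine Submodule.eq_of_le_of_finrank_eq (Submodule.span_le.2 ?_) ?_
  · rintro _ ⟨i, rfl⟩
    fin_cases i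
    · exact hb.1
    · exact hb.2
    · exact hwW
  · refine Eq.trans (Λ.isPositiveThreeSpace_span
      (Λ.orthogonal_triple (Λ.base_re_im l) hw) fun i => ?_).1 hW.1.symm
    fin_cases i
    · exact Λ.base_re_pos l
    · exact (Λ.base_im_im l).symm ▸ Λ.base_re_pos l
    · exact hwp

/-- The coefficients `p` and `q` sit in degrees zero and one, where the term with `r` cannot cancel
them; so the roots are those of a nonzero polynomial. -/
theorem countable_setOf_quadratic_eq_zero {p q r : ℂ} (h : p ≠ 0 ∨ q ≠ 0) :
    {t : ℝ | p + (t : ℂ) * q - (t : ℂ) ^ 2 * r = 0}.Countable := by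
  open Polynomial in
  let P : ℂ[X] := C p + X * C q - X ^ 2 * C r
  have hP : P ≠ 0 := by
    intro h0
    have h1 : P.coeff 0 = p := by simp [P]
    have h2 : P.coeff 1 = q := by simp [P]
    rw [h0, Polynomial.coeff_zero] at h1 h2
    exact h.elim (fun h => h h1.symm) fun h => h h2.symm
  have hfin : {z : ℂ | P.IsRoot z}.Finite := Polynomial.finite_setOfPred_isRoot hP
  refine ((hfin.preimage Complex.ofReal_injective.injOn).subset fun t ht => ?_).countable
  have ht : p + (t : ℂ) * q - (t : ℂ) ^ 2 * r = 0 := ht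
  simp only [P, mem_preimage, mem_ofPred_eq, Polynomial.IsRoot, Polynomial.eval_sub, Polynomial.eval_add,
    Polynomial.eval_mul, Polynomial.eval_pow, Polynomial.eval_X, Polynomial.eval_C, ht]

/-- Along a curve in a generic hyperkähler line, the Picard lattice is trivial except for countably
many parameters. -/
theorem countable_setOf_pic_pos {l : Λ.Per} (hW : Λ.IsGHK W) (hl : l ∈ Λ.hkLine W)
    {w : Fin b → ℝ} (hw : w ∈ Λ.planePerp l) (hwW : w ∈ W) (hwp : 0 < Λ.form ℝ w w) :
    {t : ℝ | t • Λ.dir l w 1 ∈ (Λ.chart l).target ∧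
      0 < Module.finrank ℤ (Λ.pic ((Λ.chart l).symm (t • Λ.dir l w 1)))}.Countable := by
  have hx : ∀ x : Fin b → ℤ, x ≠ 0 →
      {t : ℝ | Λ.form ℂ (fun i => (x i : ℂ)) (Λ.lift l (t • Λ.dir l w 1)) = 0}.Countable := by
    intro x hx
    set X : Fin b → ℝ := fun i => (x i : ℝ)
    have hX : (fun i => (x i : ℂ)) = ofRealVec X := by
      ext i
      simp [ofRealVec, X]
    rw [hX]
    obtain ⟨k, hk⟩ := Λ.form_lift_dir hw 1 (ofRealVec X)
    simp only [hk]
    apply countable_setOf_quadratic_eq_zero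
    -- If both coefficients vanish, `x` is orthogonal to the real and imaginary parts of the base
    -- vector and to `w`. These span `W`, so genericity gives `x = 0`.
    by_contra! h
    obtain ⟨h1, h2⟩ := h
    rw [form_ofRealVec_left, Complex.ext_iff] at h1
    rw [one_mul, form_ofRealVec, Complex.ofReal_eq_zero] at h2
    refine hx ?_
    have h3 := hW.2 (fun i => (x i : ℚ)) fun v hv => ?_
    · ext i
      have hi : ((x i : ℤ) : ℚ) = 0 := congrFun h3 i
      exact_mod_cast hi
    · have hXq : (fun i => (((x i : ℤ) : ℚ) : ℝ)) = X := by
        ext i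
        simp [X]
      rw [hXq]
      rw [← eq_span_triple hW.1 hl hw hwW hwp] at hv
      have hle : Submodule.span ℝ (range (![reVec (Λ.base l), imVec (Λ.base l), w] :
          Fin 3 → Fin b → ℝ)) ≤ LinearMap.ker (Λ.form ℝ X) := by
        rw [Submodule.span_le]
        rintro _ ⟨i, rfl⟩
        fin_cases i
        · exact h1.1
        · exact h1.2
        · exact h2
      exact hle hv
  refine (countable_iUnion fun x : {x : Fin b → ℤ // x ≠ 0} => hx x.1 x.2).mono ?_
  rintro t ⟨ht, hpic⟩
  obtain ⟨c, hc, hrep⟩ := Λ.exists_chart_symm_rep ht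
  have hne : Λ.pic ((Λ.chart l).symm (t • Λ.dir l w 1)) ≠ ⊥ := by
    intro h
    rw [h, finrank_bot] at hpic
    exact lt_irrefl _ hpic
  obtain ⟨x, hxp, hx0⟩ := Submodule.exists_mem_ne_zero_of_ne_bot hne
  refine mem_iUnion.2 ⟨⟨x, hx0⟩, ?_⟩
  have h1 : Λ.form ℂ ((Λ.chart l).symm (t • Λ.dir l w 1)).1.rep (fun i => (x i : ℂ)) = 0 := hxp.1
  rw [hrep, map_smul, LinearMap.smul_apply, smul_eq_mul, mul_eq_zero] at h1
  exact (Λ.form_symm _ _).trans (h1.resolve_left hc)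

variable {M : Type*} [TopologicalSpace M] {ψ : M → Λ.Per}

/-- Over a generic hyperkähler line there is a continuous section through every point. -/
theorem CompatibleWithGHKLines.exists_section (h : Λ.CompatibleWithGHKLines ψ)
    (hψ : IsLocalHomeomorph ψ) (hW : Λ.IsGHK W) {m : M} (hm : ψ m ∈ Λ.hkLine W) :
    ∃ σ, IsSectionOn ψ (Λ.hkLine W) σ ∧ σ (ψ m) = m := by
  obtain ⟨copies, Y, hX, -, hcop, hY⟩ := h W hW
  -- Every point of `ψ⁻¹(S_W)` lies on a copy, even if it belongs to `Y`: lift a short curve of the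
  -- line, starting at `m`, by the local inverse of `ψ`.
  obtain ⟨T, hT, hmT⟩ : ∃ T ∈ copies, m ∈ T := by
    obtain ⟨w, hwW, hw, hwp⟩ := Λ.exists_mem_inf_perp hW.1 (reVec (Λ.base (ψ m)))
      (imVec (Λ.base (ψ m)))
    set ζ := Λ.dir (ψ m) w 1
    obtain ⟨e, hme, he⟩ := hψ m
    have hc : ContinuousAt (fun t : ℝ => t • ζ) 0 := by fun_prop
    have h0 : (0 : ℝ) • ζ = 0 := zero_smul ℝ ζ
    have htar : ∀ᶠ t : ℝ in 𝓝 0, t • ζ ∈ (Λ.chart (ψ m)).target :=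
      hc.eventually_mem ((Λ.chart (ψ m)).open_target.mem_nhds
        (h0.symm ▸ zero_mem_chart_target (ψ m)))
    have hγ : ContinuousAt (fun t : ℝ => (Λ.chart (ψ m)).symm (t • ζ)) 0 := by
      refine ContinuousAt.comp (f := fun t : ℝ => t • ζ) ?_ hc
      exact (Λ.chart (ψ m)).continuousAt_symm (h0.symm ▸ zero_mem_chart_target (ψ m))
    have hγ0 : (Λ.chart (ψ m)).symm ((0 : ℝ) • ζ) = ψ m := by rw [h0, chart_symm_zero]
    have hme' : ψ m ∈ e.target := by
      rw [he]
      exact e.map_source hme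
    have hetar : ∀ᶠ t : ℝ in 𝓝 0, (Λ.chart (ψ m)).symm (t • ζ) ∈ e.target :=
      hγ.eventually_mem (e.open_target.mem_nhds (hγ0.symm ▸ hme'))
    obtain ⟨ε, hε, hball⟩ := Metric.eventually_nhds_iff_ball.1 (htar.and hetar)
    -- Only countably many parameters have Picard lattice of positive rank, so the curve can be
    -- stopped at a point outside of `Y`, hence on a copy.
    obtain ⟨t₀, ht₀, ht₀0, ht₀ε⟩ := ((countable_setOf_pic_pos hW hm hw hwW hwp).dense_compl
      ℝ).exists_between hε
    have hin : ∀ t ∈ Icc 0 t₀, t ∈ Metric.ball (0 : ℝ) ε := by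
      intro t ht
      rw [Metric.mem_ball, Real.dist_eq, sub_zero, _root_.abs_of_nonneg ht.1]
      exact ht.2.trans_lt ht₀ε
    let δ : ℝ → M := fun t => e.symm ((Λ.chart (ψ m)).symm (t • ζ))
    have hψδ : ∀ t ∈ Icc 0 t₀, ψ (δ t) = (Λ.chart (ψ m)).symm (t • ζ) := by
      intro t ht
      have := e.right_inv (hball t (hin t ht)).2
      rwa [← he] at this
    have hδX : ∀ t ∈ Icc 0 t₀, δ t ∈ ψ ⁻¹' Λ.hkLine W := by
      intro t ht
      rw [mem_preimage, hψδ t ht]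
      exact Λ.chart_symm_mem_hkLine hw hwW hm (hball t (hin t ht)).1
    have hδc : ContinuousOn δ (Icc 0 t₀) := by
      refine e.continuousOn_symm.comp ((Λ.chart (ψ m)).continuousOn_symm.comp (by fun_prop)
        fun t ht => (hball t (hin t ht)).1) fun t ht => (hball t (hin t ht)).2
    have ht₀m : t₀ ∈ Icc 0 t₀ := ⟨ht₀0.le, le_rfl⟩
    have hnY : δ t₀ ∉ Y := by
      intro hy
      have := hY _ hy
      rw [hψδ t₀ ht₀m] at this
      exact ht₀ ⟨(hball t₀ (hin t₀ ht₀m)).1, this⟩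
    have hmem : δ t₀ ∈ ⋃₀ copies ∪ Y := hX ▸ hδX t₀ ht₀m
    obtain ⟨T, hT, hδT⟩ := hmem.resolve_right hnY
    refine ⟨T, hT, ?_⟩
    obtain ⟨hcl, hop, -⟩ := hcop T hT
    have : PreconnectedSpace (Icc 0 t₀) := isPreconnected_iff_preconnectedSpace.1 isPreconnected_Icc
    let δ' : Icc 0 t₀ → ψ ⁻¹' Λ.hkLine W := fun t => ⟨δ t, hδX t t.2⟩
    have hδ' : Continuous δ' := (continuousOn_iff_continuous_domRestrict.1 hδc).subtype_mk _
    -- The copy is open and closed in `ψ⁻¹(S_W)`, so it contains the whole lifted curve, in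
    -- particular its start `m`.
    have hsub := (isPreconnected_range hδ').subset_isClopen ⟨hcl, hop⟩
      ⟨δ' ⟨t₀, ht₀m⟩, ⟨_, rfl⟩, hδT⟩
    have h1 : δ 0 ∈ T := hsub ⟨⟨0, ⟨le_rfl, ht₀0.le⟩⟩, rfl⟩
    have h2 : δ 0 = m := by
      change e.symm ((Λ.chart (ψ m)).symm ((0 : ℝ) • ζ)) = m
      rw [hγ0, he, e.left_inv hme]
    rwa [h2] at h1
  obtain ⟨-, -, f, hf⟩ := hcop T hT
  classical
  let σ : Λ.Per → M := fun l => if hl : l ∈ Λ.hkLine W then (f.symm ⟨l, hl⟩ : M) else m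
  have hσ : ∀ l (hl : l ∈ Λ.hkLine W), σ l = f.symm ⟨l, hl⟩ := fun l hl => dif_pos hl
  refine ⟨σ, ⟨?_, fun l hl => ?_⟩, ?_⟩
  · rw [continuousOn_iff_continuous_domRestrict]
    refine (continuous_subtype_val.comp f.symm.continuous).congr fun l => ?_
    exact (hσ l.1 l.2).symm
  · rw [hσ l hl, ← hf, f.apply_symm_apply]
  · have h1 : f ⟨m, hmT⟩ = ⟨ψ m, hm⟩ := Subtype.ext (hf ⟨m, hmT⟩)
    rw [hσ _ hm, ← h1, f.symm_apply_apply]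

/-- Compatibility enters twice: it gives the initial section over the GHK line of minimal energy,
and it lifts each descent curve, by a section over the GHK line containing that curve. -/
theorem CompatibleWithGHKLines.hasGlobalSections [T2Space M] [RegularSpace M]
    (h : Λ.CompatibleWithGHKLines ψ) (hψ : IsLocalHomeomorph ψ) : HasGlobalSections ψ := by
  intro x
  have : LocallyConnectedSpace Λ.Per :=
    ChartedSpace.locallyConnectedSpace (Fin (b - 2) → ℂ) Λ.Per
  obtain ⟨e, he, hGHK, hmem⟩ := exists_isOrthonormal_isGHK (ψ x)
  obtain ⟨σ₀, hσ₀, hx⟩ := h.exists_section hψ hGHK hmem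
  rw [← he.setOf_perEnergy_le_one] at hσ₀ hmem
  obtain ⟨σ, hσ, hσσ₀⟩ := hσ₀.exists_extend_univ hψ (Λ.continuous_perEnergy e)
    he.isCompact_setOf_perEnergy_le fun p hp => by
      obtain ⟨W, hW, d, hd⟩ := he.exists_localDescent hp
      refine ⟨d, fun m hm => ?_⟩
      have hlen : d.len ∈ Icc 0 d.len := ⟨d.len_pos.le, le_rfl⟩
      obtain ⟨τ, hτ, hτm⟩ := h.exists_section hψ hW (m := m) (hm ▸ hd _ hlen)
      refine ⟨fun t => τ (d.flow t p), hτ.1.comp (d.continuousOn_curve d.self_mem) hd,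
        fun t ht => hτ.2 _ (hd t ht), ?_⟩
      change τ (d.flow d.len p) = m
      rw [← hm, hτm]
  exact ⟨σ, continuousOn_univ.1 hσ.1, fun y => hσ.2 y (mem_univ y), (hσσ₀ hmem).trans hx⟩

end GHKLines

end BBFLattice

theorem mainTheorem11 {b : ℕ} (Λ : BBFLattice b)
    {E : Type*} [NormedAddCommGroup E] [NormedSpace ℝ E] [FiniteDimensional ℝ E]
    {H : Type*} [TopologicalSpace H] (I : ModelWithCorners ℝ E H) [I.Boundaryless]
    {M : Type*} [TopologicalSpace M] [T2Space M] [ChartedSpace H M] [IsManifold I ∞ M]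
    (ψ : M → Λ.Per)
    (hψ : IsLocalDiffeomorph I 𝓘(ℝ, Fin (b - 2) → ℂ) ∞ ψ)
    (hGHK : Λ.CompatibleWithGHKLines ψ) :
    IsCoveringMap ψ ∧
    (∀ x : M, ∃ U : TopologicalSpace.Opens M, (U : Set M) = connectedComponent x ∧
      ∃ Φ : U ≃ₘ^∞⟮I, 𝓘(ℝ, Fin (b - 2) → ℂ)⟯ Λ.Per, ∀ y : U, Φ y = ψ y) ∧
    (∀ R : Set Λ.Per, IsConnected R → ∀ x ∈ ψ ⁻¹' R, exceptionalSet ψ R x = ∅) := by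
  -- Local compactness, together with the Hausdorff property, makes `M` regular, as the extension of
  -- sections by limits requires.
  have : LocallyCompactSpace M := Manifold.locallyCompact_of_finiteDimensional I
  have : PreconnectedSpace Λ.Per := Λ.preconnectedSpace_per
  have h : HasGlobalSections ψ := hGHK.hasGlobalSections hψ.isLocalHomeomorph
  exact ⟨h.isCoveringMap hψ.isLocalHomeomorph, fun x => h.exists_diffeomorph hψ x,
    fun R hR x hx => h.exceptionalSet_eq_empty hR.isPreconnected hx⟩
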